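/- **Theorem (Inversion).** Let $n\ge 1$, $m\ge 0$ be integers, $s\in\mathbb R$ and $t>-\frac n2$. *Spaces.* $H^s_t(S^m\mathbb R^n)$ is the completion of the space of Schwartz symmetric $m$-tensor fields (with complex components) in the norm $\|f\|^2=\int_{\mathbb R^n}|y|^{2t}(1+|y|^2)^{s-t}|\widehat f(y)|^2\,dy$. $H^s_t(\mathbb S^{n-1}\times\mathbb R)$ is the space of $\varphi(\omega,p)$, measurable in $\omega$ and given by their Fourier transform $\widehat\varphi(\omega,\sigma)$ in $p$, with finite norm $\|\varphi\|^2=\frac1{2(2\pi)^{n-1}}\int_{\mathbb S^{n-1}}\int_{\mathbb R}|\sigma|^{2t}(1+\sigma^2)^{s-t}|\widehat\varphi(\omega,\sigma)|^2\,d\sigma\,d\omega$; on it $\partial_p$ acts as multiplication of $\widehat\varphi$ by $i\sigma$. *Operators.* For Schwartz fields $(\mathrm d u)_{i_1\dots i_{k+1}}=\sigma(i_1,\dots,i_{k+1})\,\partial u_{i_1\dots i_k}/\partial x_{i_{k+1}}$ with $\sigma$ the symmetrization, and $(\delta u)_{i_1\dots i_{k-1}}=\partial u_{i_1\dots i_{k-1}i}/\partial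 x_i$. Fix, measurably in $\omega\in\mathbb S^{n-1}$, an orthonormal basis $\omega_1,\dots,\omega_{n-1}$ of $\omega^\perp$. For $\ell_1+\dots+\ell_n=m$ put $$\mathcal R^m_{\ell_1\dots\ell_n}f(\omega,p)=\int_{\omega^\perp}\big\langle f(p\omega+y),\ \omega_1^{\odot\ell_1}\odot\dots\odot\omega_{n-1}^{\odot\ell_{n-1}}\odot\omega^{\odot\ell_n}\big\rangle\,dy ,\qquad \overline{\mathcal R}f(\omega,p)=\int_{\omega^\perp}f(p\omega+y)\,dy ,$$ where $\odot$ is the symmetrized tensor product. All these operators are extended by continuity: $\mathrm d^i:H^{s+i}_{t+i}\to H^s_t$, $\delta^i:H^s_t\to H^{s-i}_t$, and $\mathcal R^m_{\ell_1\dots\ell_n},\overline{\mathcal R}:H^s_t\to H^{s+(n-1)/2}_{t+(n-1)/2}(\mathbb S^{n-1}\times\mathbb R)$. Then: 1. Every $f\in H^s_t(S^m\mathbb R^n)$ has a unique decomposition $f=\sum_{i=0}^m\mathrm d^iv_i$ with $v_i\in H^{s+i}_{t+i}(S^{m-i}\mathbb R^n)$ and $\delta v_i=0$ for $0\le i\le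 m-1$. 2. For each $i\in\{0,\dots,m\}$, the component $v_i$ is uniquely determined by the data $\mathcal R^m_{\ell_1\dots\ell_{n-1}i}f$, $\ell_1+\dots+\ell_{n-1}=m-i$: if $f,g\in H^s_t(S^m\mathbb R^n)$ have the same such data, then their $i$-th components coincide. 3. Consequently $f$ is uniquely determined by all $\mathcal R^m_{\ell_1\dots\ell_n}f$, $\ell_1+\dots+\ell_n=m$. 4. For each $i\in\{0,\dots,m\}$, for almost every $\omega$ and as functions of $p$ in the above sense, $$\overline{\mathcal R}\big(\delta^i\mathrm d^iv_i\big)=\sum_{\ell_1+\dots+\ell_{n-1}=m-i}\frac{(m-i)!}{\ell_1!\cdots\ell_{n-1}!}\,\Big(\frac{\partial^i}{\partial p^i}\mathcal R^m_{\ell_1\dots\ell_{n-1}i}f\Big)\ \omega_1^{\odot\ell_1}\odot\dots\odot\omega_{n-1}^{\odot\ell_{n-1}} .$$ -/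

import Mathlib

open MeasureTheory
open scoped SchwartzMap FourierTransform LineDeriv ENNReal

noncomputable section

namespace TensorRadon

/-- Euclidean space `ℝⁿ`. -/
abbrev E (n : ℕ) := EuclideanSpace ℝ (Fin n)

/-- The unit sphere `𝕊ⁿ⁻¹` of `ℝⁿ`. -/
abbrev Sph (n : ℕ) := Metric.sphere (0 : E n) 1

/-! ### Weights and Sobolev spaces -/

/-- The radial weight `|r|^{2t} (1 + r²)^{s-t}`. -/
def wt (s t r : ℝ) : ℝ := |r| ^ (2 * t) * (1 + r ^ 2) ^ (s - t)

lemma wt_nonneg (s t r : ℝ) : 0 ≤ wt s t r := by unfold wt; positivity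

lemma measurable_wt (s t : ℝ) : Measurable (wt s t) := by unfold wt; fun_prop

/-- The measure `|y|^{2t} (1 + |y|²)^{s-t} dy` on `ℝⁿ`. -/
def sobMeasure (n : ℕ) (s t : ℝ) : Measure (E n) :=
  volume.withDensity fun y => ENNReal.ofReal (wt s t ‖y‖)

lemma one_add_sq_rpow_le {r : ℝ} (hr : 0 ≤ r) (a : ℝ) :
    (1 + r ^ 2) ^ a ≤ (1 + r) ^ (2 * |a|) := by
  calc (1 + r ^ 2) ^ a ≤ (1 + r ^ 2) ^ |a| :=
        Real.rpow_le_rpow_of_exponent_le (by nlinarith) (le_abs_self a)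
    _ ≤ ((1 + r) ^ 2) ^ |a| := by
        apply Real.rpow_le_rpow (by positivity) (by nlinarith) (abs_nonneg a)
    _ = (1 + r) ^ (2 * |a|) := by
        rw [Real.rpow_mul (by positivity)]; norm_num

lemma integrableOn_wt {n : ℕ} [NeZero n] {s t : ℝ} (ht : -(n : ℝ) / 2 < t) :
    ∃ N : ℕ, IntegrableOn
      (fun r : ℝ => r ^ (n - 1) • (wt s t r * (1 + r) ^ (-(N : ℝ)))) (Set.Ioi 0) := by
  obtain ⟨N, hN⟩ := exists_nat_gt (2 * |s - t| + |(n : ℝ) - 1 + 2 * t| + 2)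
  refine ⟨N, ?_⟩
  have hn1 : ((n - 1 : ℕ) : ℝ) = (n : ℝ) - 1 := by
    rw [Nat.cast_sub NeZero.one_le]; simp
  have hmeas : AEStronglyMeasurable
      (fun r : ℝ => r ^ (n - 1) • (wt s t r * (1 + r) ^ (-(N : ℝ)))) := by
    refine Measurable.aestronglyMeasurable ?_
    have := measurable_wt s t
    fun_prop
  have key : ∀ r : ℝ, 0 < r → ‖r ^ (n - 1) • (wt s t r * (1 + r) ^ (-(N : ℝ)))‖ ≤
      r ^ ((n : ℝ) - 1 + 2 * t) * (1 + r) ^ (2 * |s - t| - N) := by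
    intro r hr
    have h0 : 0 ≤ r ^ (n - 1) • (wt s t r * (1 + r) ^ (-(N : ℝ))) := by
      have := wt_nonneg s t r
      simp only [smul_eq_mul]; positivity
    rw [Real.norm_of_nonneg h0, smul_eq_mul, wt, abs_of_pos hr, Real.rpow_add hr, sub_eq_add_neg _
      (N : ℝ), Real.rpow_add (by positivity), ← Real.rpow_natCast, hn1]
    have := one_add_sq_rpow_le hr.le (s - t)
    calc _ = r ^ ((n : ℝ) - 1) * r ^ (2 * t) * ((1 + r ^ 2) ^ (s - t) * (1 + r) ^ (-(N : ℝ))) := by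
            ring
      _ ≤ _ := by gcongr
  rw [← Set.Ioc_union_Ioi_eq_Ioi (zero_le_one' ℝ)]
  refine IntegrableOn.union ?_ ?_
  · have hI : IntegrableOn (fun r : ℝ => r ^ ((n : ℝ) - 1 + 2 * t)) (Set.Ioc 0 1) := by
      rw [← intervalIntegrable_iff_integrableOn_Ioc_of_le zero_le_one]
      exact intervalIntegral.intervalIntegrable_rpow' (by linarith)
    refine Integrable.mono' hI hmeas.restrict ?_
    refine (ae_restrict_iff' measurableSet_Ioc).2 (ae_of_all _ fun r hr => (key r hr.1).trans ?_)
    refine mul_le_of_le_one_right (by have := hr.1; positivity) ?_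
    refine Real.rpow_le_one_of_one_le_of_nonpos (by linarith [hr.1]) ?_
    linarith [abs_nonneg ((n : ℝ) - 1 + 2 * t)]
  · have hI : IntegrableOn (fun r : ℝ => r ^ (-2 : ℝ)) (Set.Ioi 1) :=
      integrableOn_Ioi_rpow_of_lt (by norm_num) one_pos
    refine Integrable.mono' hI hmeas.restrict ?_
    refine (ae_restrict_iff' measurableSet_Ioi).2 (ae_of_all _ fun r hr => ?_)
    have hr1 : (1 : ℝ) < r := hr
    have hr0 : (0 : ℝ) < r := by linarith
    refine (key r hr0).trans ?_
    have h1 : (1 + r) ^ (2 * |s - t| - N) ≤ r ^ (2 * |s - t| - N) :=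
      Real.rpow_le_rpow_of_nonpos hr0 (by linarith)
        (by linarith [abs_nonneg ((n : ℝ) - 1 + 2 * t)])
    calc _ ≤ r ^ ((n : ℝ) - 1 + 2 * t) * r ^ (2 * |s - t| - N) := by gcongr
      _ = r ^ ((n : ℝ) - 1 + 2 * t + (2 * |s - t| - N)) := (Real.rpow_add hr0 _ _).symm
      _ ≤ r ^ (-2 : ℝ) := Real.rpow_le_rpow_of_exponent_le hr1.le
        (by linarith [le_abs_self ((n : ℝ) - 1 + 2 * t)])

instance sobMeasure_hasTemperateGrowth (n : ℕ) [NeZero n] (s t : ℝ)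
    [h : Fact (-(n : ℝ) / 2 < t)] : (sobMeasure n s t).HasTemperateGrowth := by
  obtain ⟨N, hN⟩ := integrableOn_wt (s := s) h.out
  refine ⟨N, ?_⟩
  have : Nontrivial (E n) := by
    have : Nonempty (Fin n) := ⟨0⟩
    infer_instance
  unfold sobMeasure
  rw [integrable_withDensity_iff_integrable_smul']
  · have h2 := (integrable_fun_norm_addHaar (E := E n) volume
      (f := fun r : ℝ => wt s t r * (1 + r) ^ (-(N : ℝ)))).2 (by simpa using hN)
    refine h2.congr (ae_of_all _ fun y => ?_)
    simp [ENNReal.toReal_ofReal (wt_nonneg s t _)]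
  · exact ((measurable_wt s t).comp measurable_norm).ennreal_ofReal
  · simp

section Fourier

variable {n : ℕ} {F G : Type*} [NormedAddCommGroup F] [NormedSpace ℂ F]
  [NormedAddCommGroup G] [NormedSpace ℂ G]

/-- The dilation `y ↦ y / (2π)`. -/
def dil (n : ℕ) : E n ≃L[ℝ] E n :=
  ContinuousLinearEquiv.smulLeft (Units.mk0 ((2 * Real.pi)⁻¹ : ℝ) (by positivity))

/-- The Fourier transform `f̂(y) = (2π)^{-n/2} ∫ e^{-i⟨x,y⟩} f(x) dx` on Schwartz functions, see
`ft_apply`. -/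
def ft : 𝓢(E n, F) →ₗ[ℂ] 𝓢(E n, F) :=
  (((2 * Real.pi) ^ (-(n : ℝ) / 2) : ℝ) : ℂ) •
    ((SchwartzMap.compCLMOfContinuousLinearEquiv ℂ (dil n)).toLinearMap ∘ₗ
      (SchwartzMap.fourierTransformCLM ℂ).toLinearMap)

lemma ft_eq (f : 𝓢(E n, F)) (y : E n) :
    ft f y = (((2 * Real.pi) ^ (-(n : ℝ) / 2) : ℝ) : ℂ) • (𝓕 f) ((2 * Real.pi)⁻¹ • y) := rfl

lemma ft_apply (f : 𝓢(E n, F)) (y : E n) :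
    ft f y = (((2 * Real.pi) ^ (-(n : ℝ) / 2) : ℝ) : ℂ) •
      ∫ x, Complex.exp (-Complex.I * (inner ℝ x y : ℝ)) • f x := by
  rw [ft_eq, SchwartzMap.fourier_coe, Real.fourier_eq']
  congr 1
  refine integral_congr_ae (ae_of_all _ fun x => ?_)
  simp only
  congr 2
  rw [inner_smul_right]
  push_cast
  have : (Real.pi : ℂ) ≠ 0 := by exact_mod_cast Real.pi_ne_zero
  field_simp

lemma ft_lineDeriv (f : 𝓢(E n, F)) (m y : E n) :
    ft (∂_{m} f) y = (Complex.I * (inner ℝ y m : ℝ)) • ft f y := by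
  have h := SchwartzMap.fourier_lineDerivOp_eq f m
  rw [ft_eq, ft_eq, h]
  have htg : (inner ℝ · m : E n → ℝ).HasTemperateGrowth := by fun_prop
  rw [smul_comm (Complex.I * _)]
  congr 1
  rw [smul_apply, SchwartzMap.smulLeftCLM_apply_apply htg, inner_smul_left,
    ← Complex.coe_smul, smul_smul]
  congr 1
  have : (Real.pi : ℂ) ≠ 0 := by exact_mod_cast Real.pi_ne_zero
  simp
  field_simp

lemma ft_postcomp (L : F →L[ℂ] G) (f : 𝓢(E n, F)) (y : E n) [CompleteSpace F] [CompleteSpace G] :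
    ft (f.postcompCLM L) y = L (ft f y) := by
  rw [ft_apply, ft_apply, map_smul, ← L.integral_comp_comm]
  · simp
  · rw [← integrable_norm_iff]
    · have : Integrable (fun x => ‖f x‖) volume := f.integrable.norm
      refine this.congr (ae_of_all _ fun x => ?_)
      simp [norm_smul, Complex.norm_exp]
    · refine Continuous.aestronglyMeasurable ?_
      have := f.continuous
      fun_prop

end Fourier

section Sobolev

variable (n : ℕ) [NeZero n] (s t : ℝ) [Fact (-(n : ℝ) / 2 < t)]
  (F : Type*) [NormedAddCommGroup F] [NormedSpace ℂ F]

/-- The Fourier transform from Schwartz functions to the weighted `L²` space. -/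
def ftLp : 𝓢(E n, F) →ₗ[ℂ] Lp F 2 (sobMeasure n s t) :=
  (SchwartzMap.toLpCLM ℂ F 2 (sobMeasure n s t)).toLinearMap ∘ₗ ft

/-- The Schwartz space with the norm of `H^s_t`, see `norm_sq_preSob`. -/
def PreSob (n : ℕ) (_s _t : ℝ) (F : Type*) [NormedAddCommGroup F] [NormedSpace ℂ F] : Type _ :=
  𝓢(E n, F)

instance : AddCommGroup (PreSob n s t F) := inferInstanceAs (AddCommGroup 𝓢(E n, F))

instance : Module ℂ (PreSob n s t F) := inferInstanceAs (Module ℂ 𝓢(E n, F))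

/-- `ftLp` on `PreSob`. -/
def preSobFt : PreSob n s t F →ₗ[ℂ] Lp F 2 (sobMeasure n s t) := ftLp n s t F

instance : SeminormedAddCommGroup (PreSob n s t F) :=
  SeminormedAddCommGroup.induced _ _ (preSobFt n s t F)

instance : NormedSpace ℂ (PreSob n s t F) := NormedSpace.induced _ _ _ (preSobFt n s t F)

/-- The space `H^s_t` of `F`-valued functions on `ℝⁿ`: the completion of the Schwartz space with
respect to the norm `‖f‖² = ∫ |y|^{2t} (1 + |y|²)^{s-t} |f̂(y)|² dy`. -/
abbrev Sob : Type _ := UniformSpace.Completion (PreSob n s t F)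

/-- The canonical map from the Schwartz space to `H^s_t`. -/
def toSob : 𝓢(E n, F) →ₗ[ℂ] Sob n s t F :=
  (UniformSpace.Completion.toComplL (𝕜 := ℂ) (E := PreSob n s t F)).toLinearMap

variable {n F}

lemma denseRange_toSob : DenseRange (toSob n s t F) :=
  UniformSpace.Completion.denseRange_coe (α := PreSob n s t F)

lemma norm_toSob_eq (f : 𝓢(E n, F)) :
    ‖toSob n s t F f‖ = (eLpNorm (ft f) 2 (sobMeasure n s t)).toReal := by
  refine (UniformSpace.Completion.norm_coe (E := PreSob n s t F) f).trans ?_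
  exact Lp.norm_toLp _ ((ft f).memLp 2 (sobMeasure n s t))

lemma norm_toSob_sq (f : 𝓢(E n, F)) :
    ‖toSob n s t F f‖ ^ 2 = ∫ y, ‖y‖ ^ (2 * t) * (1 + ‖y‖ ^ 2) ^ (s - t) * ‖ft f y‖ ^ 2 := by
  have h := (ft f).memLp 2 (sobMeasure n s t)
  rw [norm_toSob_eq, h.eLpNorm_eq_integral_rpow_norm (by simp) (by simp),
    ENNReal.toReal_ofReal (by positivity), ← Real.rpow_natCast, ← Real.rpow_mul (by positivity)]
  simp only [ENNReal.toReal_ofNat, Nat.cast_ofNat, Real.rpow_ofNat]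
  rw [inv_mul_cancel₀ (by norm_num), Real.rpow_one, sobMeasure, integral_withDensity_eq_integral_toReal_smul]
  · refine integral_congr_ae (ae_of_all _ fun y => ?_)
    simp only [ENNReal.toReal_ofReal (wt_nonneg s t _), smul_eq_mul]
    simp [wt]
  · exact ((measurable_wt s t).comp measurable_norm).ennreal_ofReal
  · simp

lemma integrable_wt_ft (f : 𝓢(E n, F)) :
    Integrable (fun y => ‖y‖ ^ (2 * t) * (1 + ‖y‖ ^ 2) ^ (s - t) * ‖ft f y‖ ^ 2) volume := by
  have := (((ft f).memLp 2 (sobMeasure n s t))).integrable_norm_pow (by norm_num)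
  rw [sobMeasure, integrable_withDensity_iff_integrable_smul'] at this
  · refine this.congr (ae_of_all _ fun y => ?_)
    simp only [ENNReal.toReal_ofReal (wt_nonneg s t _), smul_eq_mul]
    simp [wt]
  · exact ((measurable_wt s t).comp measurable_norm).ennreal_ofReal
  · simp

variable {s t}

/-- A pointwise bound on the Fourier side gives a bound between the norms. -/
lemma norm_toSob_le {G : Type*} [NormedAddCommGroup G] [NormedSpace ℂ G] {s' t' : ℝ}
    [Fact (-(n : ℝ) / 2 < t')] (f : 𝓢(E n, F)) (g : 𝓢(E n, G)) {C : ℝ} (hC : 0 ≤ C)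
    (h : ∀ y : E n, y ≠ 0 → ‖y‖ ^ (2 * t') * (1 + ‖y‖ ^ 2) ^ (s' - t') * ‖ft g y‖ ^ 2 ≤
      C ^ 2 * (‖y‖ ^ (2 * t) * (1 + ‖y‖ ^ 2) ^ (s - t) * ‖ft f y‖ ^ 2)) :
    ‖toSob n s' t' G g‖ ≤ C * ‖toSob n s t F f‖ := by
  refine abs_le_of_sq_le_sq' ?_ (by positivity) |>.2
  rw [mul_pow, norm_toSob_sq, norm_toSob_sq, ← integral_const_mul]
  have : Nontrivial (E n) := by
    have : Nonempty (Fin n) := ⟨0⟩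
    infer_instance
  refine integral_mono_ae (integrable_wt_ft s' t' g) ((integrable_wt_ft s t f).const_mul (C ^ 2)) ?_
  have h0 : ∀ᵐ y : E n, y ≠ 0 := by simp [ae_iff]
  filter_upwards [h0] with y hy
  exact h y hy

end Sobolev

instance (n : ℕ) (t : ℝ) [h : Fact (-(n : ℝ) / 2 < t)] (i : ℕ) : Fact (-(n : ℝ) / 2 < t + i) :=
  ⟨lt_add_of_lt_of_nonneg h.out (Nat.cast_nonneg i)⟩

/-! ### Symmetric tensors -/

/-- Symmetric `m`-tensors on `ℝⁿ` with complex components, with the norm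
`|T|² = ∑ |T_{i₁…iₘ}|²` (sum over all `i₁, …, iₘ`). -/
def symT (n m : ℕ) : Submodule ℂ (EuclideanSpace ℂ (Fin m → Fin n)) where
  carrier := {T | ∀ (π : Equiv.Perm (Fin m)) (I : Fin m → Fin n), T (I ∘ π) = T I}
  add_mem' hS hT π I := by simp [hS π I, hT π I]
  zero_mem' π I := by simp
  smul_mem' c T hT π I := by simp [hT π I]

/-- The type of symmetric `m`-tensors on `ℝⁿ`. -/
def SymT (n m : ℕ) : Type := ↥(symT n m)

instance (n m : ℕ) : NormedAddCommGroup (SymT n m) := inferInstanceAs (NormedAddCommGroup ↥(symT n m))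

instance (n m : ℕ) : NormedSpace ℂ (SymT n m) := inferInstanceAs (NormedSpace ℂ ↥(symT n m))

instance (n m : ℕ) : FiniteDimensional ℂ (SymT n m) :=
  inferInstanceAs (FiniteDimensional ℂ ↥(symT n m))

instance (n m : ℕ) : CompleteSpace (SymT n m) := FiniteDimensional.complete ℂ _

variable {n m k : ℕ}

/-- The component `T_{i₁…iₘ}`. -/
def SymT.comp (T : SymT n m) (I : Fin m → Fin n) : ℂ := (T : symT n m).1 I

lemma SymT.ext {S T : SymT n m} (h : ∀ I, S.comp I = T.comp I) : S = T :=
  Subtype.ext (PiLp.ext h)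

lemma SymT.comp_perm (T : SymT n m) (π : Equiv.Perm (Fin m)) (I : Fin m → Fin n) :
    T.comp (I ∘ π) = T.comp I := (T : symT n m).2 π I

lemma SymT.comp_add (S T : SymT n m) (I : Fin m → Fin n) :
    (S + T).comp I = S.comp I + T.comp I := rfl

lemma SymT.comp_smul (c : ℂ) (T : SymT n m) (I : Fin m → Fin n) :
    (c • T).comp I = c * T.comp I := rfl

/-- The symmetric tensor with given components. -/
def SymT.mk (T : (Fin m → Fin n) → ℂ) (h : ∀ (π : Equiv.Perm (Fin m)) I, T (I ∘ π) = T I) :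
    SymT n m :=
  (⟨WithLp.toLp 2 T, h⟩ : symT n m)

@[simp] lemma SymT.comp_mk (T : (Fin m → Fin n) → ℂ) (h) (I : Fin m → Fin n) :
    (SymT.mk T h).comp I = T I := rfl

lemma SymT.norm_sq (T : SymT n m) : ‖T‖ ^ 2 = ∑ I, ‖T.comp I‖ ^ 2 :=
  EuclideanSpace.norm_sq_eq (T : symT n m).1

/-- The symmetrization `(σT)_{i₁…iₘ} = (1/m!) ∑_π T_{i_{π(1)}…i_{π(m)}}`. -/
def symmetrize : ((Fin m → Fin n) → ℂ) →ₗ[ℂ] SymT n m where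
  toFun T := SymT.mk (fun I => (m.factorial : ℂ)⁻¹ * ∑ π : Equiv.Perm (Fin m), T (I ∘ π)) <| by
    intro π I
    congr 1
    exact Fintype.sum_equiv (Equiv.mulLeft π) _ _ fun ρ => rfl
  map_add' S T := by
    refine SymT.ext fun I => ?_; simp [SymT.comp_add, Finset.sum_add_distrib, mul_add]
  map_smul' c T := by
    refine SymT.ext fun I => ?_; simp [SymT.comp_smul, ← Finset.mul_sum, mul_left_comm]

/-- The symmetric product `a₁ ⊙ ⋯ ⊙ aₘ` of vectors of `ℝⁿ`. -/
def symProd (a : Fin m → E n) : SymT n m := symmetrize fun I => ∏ r, ((a r (I r) : ℝ) : ℂ)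

/-- For vectors `b j`, `j ∈ ι`, and a multi-index `α` with `∑ α j = m`, the symmetric tensor
`⊙_j (b j)^{⊙ α j}`, written as the average of `b_{J(1)} ⊗ ⋯ ⊗ b_{J(m)}` over the `m!/α!` words `J`
in which each `j` occurs exactly `α j` times. By `symPow_eq_symProd` it is `b_{J(1)} ⊙ ⋯ ⊙ b_{J(m)}`
for any such word. -/
def symPow {ι : Type*} [Fintype ι] [DecidableEq ι] (b : ι → E n) (α : ι → ℕ) : SymT n m :=
  SymT.mk (fun I => ((∏ j, ((α j).factorial : ℂ)) / (m.factorial : ℂ)) *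
    ∑ J : Fin m → ι with ∀ j, (Finset.univ.filter fun r => J r = j).card = α j,
      ∏ r, ((b (J r) (I r) : ℝ) : ℂ)) <| by
    intro π I
    congr 1
    refine Finset.sum_equiv (Equiv.arrowCongr π (Equiv.refl ι)) ?_ ?_
    · intro J
      simp only [Finset.mem_filter, Finset.mem_univ, true_and]
      refine forall_congr' fun j => ?_
      rw [show (Finset.univ.filter fun r => (Equiv.arrowCongr π (Equiv.refl ι)) J r = j) =
        (Finset.univ.filter fun r => J r = j).map π.toEmbedding by
          ext r; simp [Finset.mem_map_equiv], Finset.card_map]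
    · intro J _
      refine Fintype.prod_equiv π _ _ fun r => ?_
      simp

lemma symPow_eq_symProd {ι : Type*} [Fintype ι] [DecidableEq ι] (b : ι → E n) (α : ι → ℕ)
    (J : Fin m → ι) (hJ : ∀ j, (Finset.univ.filter fun r => J r = j).card = α j) :
    (symPow b α : SymT n m) = symProd fun r => b (J r) := by
  refine SymT.ext fun I => ?_
  set S : Finset (Fin m → ι) :=
    Finset.univ.filter fun J => ∀ j, (Finset.univ.filter fun r => J r = j).card = α j with hS
  have hmaps : ∀ π : Equiv.Perm (Fin m), J ∘ π ∈ S := by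
    intro π
    simp only [hS, Finset.mem_filter, Finset.mem_univ, true_and]
    intro j
    rw [← hJ j, ← Finset.card_map π.toEmbedding]
    congr 1
    ext r
    simp [Finset.mem_map_equiv]
  have hstab : (Finset.univ.filter fun π : Equiv.Perm (Fin m) => J ∘ π = J).card =
      ∏ j, (α j).factorial := by
    have h := DomMulAct.stabilizer_card J
    rw [Fintype.card_subtype] at h
    rw [h]
    refine Finset.prod_congr rfl fun j _ => ?_
    rw [Fintype.card_subtype, hJ j]
  have hfib : ∀ J' ∈ S, (Finset.univ.filter fun π : Equiv.Perm (Fin m) => J ∘ π = J').card =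
      ∏ j, (α j).factorial := by
    intro J' hJ'
    simp only [hS, Finset.mem_filter, Finset.mem_univ, true_and] at hJ'
    have hex : ∃ ρ : Equiv.Perm (Fin m), J ∘ ρ = J' := by
      have e : ∀ j, Nonempty ({r // J' r = j} ≃ {r // J r = j}) := fun j =>
        ⟨Fintype.equivOfCardEq (by rw [Fintype.card_subtype, Fintype.card_subtype, hJ, hJ'])⟩
      exact ⟨(Equiv.sigmaFiberEquiv J').symm.trans ((Equiv.sigmaCongrRight fun j => (e j).some).trans
        (Equiv.sigmaFiberEquiv J)), funext fun r => ((e (J' r)).some ⟨r, rfl⟩).2⟩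
    obtain ⟨ρ, rfl⟩ := hex
    rw [← hstab]
    refine Finset.card_equiv (Equiv.mulRight ρ⁻¹) fun π => ?_
    simp only [Finset.mem_filter, Finset.mem_univ, true_and, Equiv.coe_mulRight]
    constructor
    · intro h
      ext r
      simpa using congrFun h (ρ⁻¹ r)
    · intro h
      ext r
      simpa using congrFun h (ρ r)
  have hsum : ∑ π : Equiv.Perm (Fin m), ∏ r, ((b (J r) (I (π r)) : ℝ) : ℂ) =
      (∏ j, ((α j).factorial : ℂ)) * ∑ J' ∈ S, ∏ r, ((b (J' r) (I r) : ℝ) : ℂ) := by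
    have h1 : ∑ π : Equiv.Perm (Fin m), ∏ r, ((b (J r) (I (π r)) : ℝ) : ℂ) =
        ∑ π : Equiv.Perm (Fin m), ∏ r, ((b ((J ∘ π) r) (I r) : ℝ) : ℂ) := by
      refine Fintype.sum_equiv (Equiv.inv _) _ _ fun π => ?_
      refine Fintype.prod_equiv π _ _ fun r => ?_
      simp
    rw [h1, ← Finset.sum_fiberwise_of_maps_to (g := fun π : Equiv.Perm (Fin m) => J ∘ π)
      (t := S) (fun π _ => hmaps π), Finset.mul_sum]
    refine Finset.sum_congr rfl fun J' hJ' => ?_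
    rw [Finset.sum_congr rfl (g := fun _ => ∏ r, ((b (J' r) (I r) : ℝ) : ℂ)) (fun π hπ => by
      simp only [Finset.mem_filter] at hπ
      rw [hπ.2]), Finset.sum_const, hfib J' hJ']
    simp
  simp only [symPow, symProd, symmetrize, SymT.comp_mk, LinearMap.coe_mk, AddHom.coe_mk,
    Function.comp_apply]
  rw [hsum]
  ring

/-- The component `T ↦ T_{i₁…iₘ}` as a linear map. -/
def compL (I : Fin m → Fin n) : SymT n m →L[ℂ] ℂ :=
  LinearMap.toContinuousLinearMap
    { toFun := fun T => T.comp I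
      map_add' := fun S T => SymT.comp_add S T I
      map_smul' := fun c T => SymT.comp_smul c T I }

/-- The bilinear pairing `⟨f, T⟩ = ∑ f_{i₁…iₘ} T^{i₁…iₘ}` with a fixed tensor `T`. -/
def pairing (T : SymT n m) : SymT n m →L[ℂ] ℂ := ∑ I, T.comp I • compL I

lemma pairing_apply (T f : SymT n m) : pairing T f = ∑ I, f.comp I * T.comp I := by
  simp [pairing, compL, mul_comm]

/-! ### The operators `d` and `δ` -/

/-- `T ↦ σ(T ⊗ e_j)`. -/
def symMulE (j : Fin n) : SymT n m →L[ℂ] SymT n (m + 1) :=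
  LinearMap.toContinuousLinearMap <| symmetrize ∘ₗ
    { toFun := fun (T : SymT n m) I => if I (Fin.last m) = j then T.comp (Fin.init I) else 0
      map_add' := fun S T => by ext I; by_cases h : I (Fin.last m) = j <;> simp [h, SymT.comp_add]
      map_smul' := fun c T => by ext I; by_cases h : I (Fin.last m) = j <;> simp [h, SymT.comp_smul] }

/-- `T ↦ T_{i₁…iₘ j}`. -/
def contractE (j : Fin n) : SymT n (m + 1) →L[ℂ] SymT n m :=
  LinearMap.toContinuousLinearMap
    { toFun := fun T => SymT.mk (fun I => T.comp (Fin.snoc I j : Fin (m + 1) → Fin n)) <| by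
        intro π I
        rw [← T.comp_perm (finSuccEquivLast.permCongr.symm (Equiv.optionCongr π)) (Fin.snoc I j)]
        congr 1
        ext r
        refine Fin.lastCases ?_ (fun r => ?_) r <;> simp [Equiv.permCongr_def]
      map_add' := fun S T => by refine SymT.ext fun I => ?_; simp [SymT.comp_add]
      map_smul' := fun c T => by refine SymT.ext fun I => ?_; simp [SymT.comp_smul] }

/-- The vector `e_j`. -/
abbrev stdE (j : Fin n) : E n := EuclideanSpace.single j 1

/-- The inner differentiation operator
`(du)_{i₁…i_{m+1}} = σ(i₁,…,i_{m+1}) ∂u_{i₁…iₘ}/∂x_{i_{m+1}}`, see `dOp_apply`. -/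
def dOp : 𝓢(E n, SymT n m) →ₗ[ℂ] 𝓢(E n, SymT n (m + 1)) :=
  ∑ j, (SchwartzMap.postcompCLM (symMulE j)).toLinearMap ∘ₗ
    (LineDeriv.lineDerivOpCLM ℂ 𝓢(E n, SymT n m) (stdE j)).toLinearMap

/-- The divergence `(δu)_{i₁…iₘ} = ∂u_{i₁…iₘ j}/∂x_j` (sum over `j`), see `divOp_apply`. -/
def divOp : 𝓢(E n, SymT n (m + 1)) →ₗ[ℂ] 𝓢(E n, SymT n m) :=
  ∑ j, (SchwartzMap.postcompCLM (contractE j)).toLinearMap ∘ₗ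
    (LineDeriv.lineDerivOpCLM ℂ 𝓢(E n, SymT n (m + 1)) (stdE j)).toLinearMap

lemma dOp_eq (u : 𝓢(E n, SymT n m)) : dOp u = ∑ j, SchwartzMap.postcompCLM (symMulE j) (∂_{stdE j} u) := by
  simp [dOp]

lemma divOp_eq (u : 𝓢(E n, SymT n (m + 1))) :
    divOp u = ∑ j, SchwartzMap.postcompCLM (contractE j) (∂_{stdE j} u) := by
  simp [divOp]

lemma SymT.comp_sum {ι : Type*} (S : Finset ι) (T : ι → SymT n m) (I : Fin m → Fin n) :
    (∑ j ∈ S, T j).comp I = ∑ j ∈ S, (T j).comp I :=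
  map_sum (⟨⟨fun T : SymT n m => T.comp I, rfl⟩, fun _ _ => rfl⟩ : SymT n m →+ ℂ) _ _

lemma dOp_apply (u : 𝓢(E n, SymT n m)) (x : E n) (I : Fin (m + 1) → Fin n) :
    (dOp u x).comp I = ((m + 1).factorial : ℂ)⁻¹ * ∑ π : Equiv.Perm (Fin (m + 1)),
      (lineDeriv ℝ u x (stdE (I (π (Fin.last m))))).comp (I ∘ π ∘ Fin.castSucc) := by
  rw [dOp_eq, sum_apply, SymT.comp_sum]
  simp only [SchwartzMap.postcompCLM_apply, SchwartzMap.lineDerivOp_apply, symMulE,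
    LinearMap.coe_toContinuousLinearMap', LinearMap.comp_apply, symmetrize, LinearMap.coe_mk,
    AddHom.coe_mk, SymT.comp_mk, Function.comp_apply]
  rw [← Finset.mul_sum, Finset.sum_comm]
  simp [Fin.init_def, Function.comp_def]

lemma divOp_apply (u : 𝓢(E n, SymT n (m + 1))) (x : E n) (I : Fin m → Fin n) :
    (divOp u x).comp I =
      ∑ j, (lineDeriv ℝ u x (stdE j)).comp (Fin.snoc I j : Fin (m + 1) → Fin n) := by
  rw [divOp_eq, sum_apply, SymT.comp_sum]
  refine Finset.sum_congr rfl fun j _ => ?_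
  rw [SchwartzMap.postcompCLM_apply, SchwartzMap.lineDerivOp_apply]
  rfl

/-- The iterate `d^i` from tensor fields of degree `k` to tensor fields of degree `m = k + i`. -/
def dPow : (i : ℕ) → {k m : ℕ} → k + i = m → 𝓢(E n, SymT n k) →ₗ[ℂ] 𝓢(E n, SymT n m)
  | 0, _, _, rfl => LinearMap.id
  | i + 1, k, _, h => dPow i (k := k + 1) (by omega) ∘ₗ dOp

/-- The iterate `δ^i` from tensor fields of degree `m = k + i` to tensor fields of degree `k`. -/
def divPow : (i : ℕ) → {k m : ℕ} → k + i = m → 𝓢(E n, SymT n m) →ₗ[ℂ] 𝓢(E n, SymT n k)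
  | 0, _, _, rfl => LinearMap.id
  | i + 1, k, _, h => divOp ∘ₗ divPow i (k := k + 1) (by omega)

section

variable [NeZero n] (s t : ℝ) [Fact (-(n : ℝ) / 2 < t)]

/-- The operator `d^i : H^{s+i}_{t+i} → H^s_t` from degree `k` to degree `m = k + i`: the extension
of `dPow` by continuity, see `dH_toSob`. -/
def dH (i : ℕ) (h : k + i = m) : Sob n (s + i) (t + i) (SymT n k) →L[ℂ] Sob n s t (SymT n m) :=
  (toSob n s t (SymT n m) ∘ₗ dPow i h).extendOfNorm (toSob n (s + i) (t + i) (SymT n k))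

/-- The operator `δ^i : H^s_t → H^{s-i}_t` from degree `m = k + i` to degree `k`: the extension
of `divPow` by continuity, see `divH_toSob`. -/
def divH (i : ℕ) (h : k + i = m) : Sob n s t (SymT n m) →L[ℂ] Sob n (s - i) t (SymT n k) :=
  (toSob n (s - i) t (SymT n k) ∘ₗ divPow i h).extendOfNorm (toSob n s t (SymT n m))

end

lemma norm_ft_dPow_le (i : ℕ) : ∀ {k m : ℕ} (h : k + i = m), ∃ C : ℝ, 0 ≤ C ∧
    ∀ (u : 𝓢(E n, SymT n k)) (y : E n), ‖ft (dPow i h u) y‖ ≤ C * ‖y‖ ^ i * ‖ft u y‖ := by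
  induction i with
  | zero => rintro k m rfl; exact ⟨1, zero_le_one, fun u y => by simp [dPow]⟩
  | succ i ih =>
    intro k m h
    obtain ⟨C, hC, H⟩ := ih (k := k + 1) (m := m) (by omega)
    refine ⟨C * ∑ j : Fin n, ‖(symMulE j : SymT n k →L[ℂ] _)‖, by positivity, fun u y => ?_⟩
    have h1 : ‖ft (dOp u) y‖ ≤ (∑ j : Fin n, ‖(symMulE j : SymT n k →L[ℂ] _)‖) * (‖y‖ * ‖ft u y‖) := by
      rw [dOp_eq, map_sum, sum_apply, Finset.sum_mul]
      refine norm_sum_le_of_le _ fun j _ => ?_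
      rw [ft_postcomp, ft_lineDeriv]
      refine ((symMulE j).le_opNorm _).trans ?_
      gcongr
      rw [norm_smul]
      gcongr
      simpa using abs_real_inner_le_norm y (stdE j)
    calc _ ≤ C * ‖y‖ ^ i * ‖ft (dOp u) y‖ := H (dOp u) y
      _ ≤ C * ‖y‖ ^ i * ((∑ j : Fin n, ‖(symMulE j : SymT n k →L[ℂ] _)‖) * (‖y‖ * ‖ft u y‖)) := by
        gcongr
      _ = _ := by ring

lemma norm_ft_divPow_le (i : ℕ) : ∀ {k m : ℕ} (h : k + i = m), ∃ C : ℝ, 0 ≤ C ∧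
    ∀ (u : 𝓢(E n, SymT n m)) (y : E n), ‖ft (divPow i h u) y‖ ≤ C * ‖y‖ ^ i * ‖ft u y‖ := by
  induction i with
  | zero => rintro k m rfl; exact ⟨1, zero_le_one, fun u y => by simp [divPow]⟩
  | succ i ih =>
    intro k m h
    obtain ⟨C, hC, H⟩ := ih (k := k + 1) (m := m) (by omega)
    refine ⟨(∑ j : Fin n, ‖(contractE j : SymT n (k + 1) →L[ℂ] _)‖) * C, by positivity,
      fun u y => ?_⟩
    have h1 : ∀ u : 𝓢(E n, SymT n (k + 1)), ‖ft (divOp u) y‖ ≤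
        (∑ j : Fin n, ‖(contractE j : SymT n (k + 1) →L[ℂ] _)‖) * (‖y‖ * ‖ft u y‖) := by
      intro u
      rw [divOp_eq, map_sum, sum_apply, Finset.sum_mul]
      refine norm_sum_le_of_le _ fun j _ => ?_
      rw [ft_postcomp, ft_lineDeriv]
      refine ((contractE j).le_opNorm _).trans ?_
      gcongr
      rw [norm_smul]
      gcongr
      simpa using abs_real_inner_le_norm y (stdE j)
    refine (h1 _).trans ?_
    calc _ ≤ (∑ j : Fin n, ‖(contractE j : SymT n (k + 1) →L[ℂ] _)‖) *
          (‖y‖ * (C * ‖y‖ ^ i * ‖ft u y‖)) := by gcongr; exact H u y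
      _ = _ := by ring

section

variable [NeZero n] (s t : ℝ) [Fact (-(n : ℝ) / 2 < t)]

lemma dH_toSob (i : ℕ) (h : k + i = m) (u : 𝓢(E n, SymT n k)) :
    dH s t i h (toSob n (s + i) (t + i) _ u) = toSob n s t _ (dPow i h u) := by
  refine LinearMap.extendOfNorm_eq (denseRange_toSob _ _) ?_ u
  obtain ⟨C, hC, H⟩ := norm_ft_dPow_le (n := n) i h
  refine ⟨C, fun u => norm_toSob_le u _ hC fun y hy => ?_⟩
  have hy' : 0 < ‖y‖ := norm_pos_iff.2 hy
  rw [add_sub_add_right_eq_sub, mul_add, Real.rpow_add hy', show (2 * (i : ℝ)) = ((2 * i : ℕ) : ℝ) by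
    push_cast; ring, Real.rpow_natCast]
  calc _ ≤ ‖y‖ ^ (2 * t) * (1 + ‖y‖ ^ 2) ^ (s - t) * (C * ‖y‖ ^ i * ‖ft u y‖) ^ 2 := by
        gcongr; exact H u y
    _ = _ := by ring

lemma divH_toSob (i : ℕ) (h : k + i = m) (u : 𝓢(E n, SymT n m)) :
    divH s t i h (toSob n s t _ u) = toSob n (s - i) t _ (divPow i h u) := by
  refine LinearMap.extendOfNorm_eq (denseRange_toSob _ _) ?_ u
  obtain ⟨C, hC, H⟩ := norm_ft_divPow_le (n := n) i h
  refine ⟨C, fun u => norm_toSob_le u _ hC fun y hy => ?_⟩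
  have h1 : 0 < 1 + ‖y‖ ^ 2 := by positivity
  have h2 : (1 + ‖y‖ ^ 2) ^ (s - t) = (1 + ‖y‖ ^ 2) ^ (s - i - t) * (1 + ‖y‖ ^ 2) ^ i := by
    rw [← Real.rpow_natCast _ i, ← Real.rpow_add h1]; congr 1; ring
  have h3 : (‖y‖ ^ 2) ^ i ≤ (1 + ‖y‖ ^ 2) ^ i := by gcongr; linarith
  rw [h2]
  calc _ ≤ ‖y‖ ^ (2 * t) * (1 + ‖y‖ ^ 2) ^ (s - i - t) * (C * ‖y‖ ^ i * ‖ft u y‖) ^ 2 := by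
        gcongr; exact H u y
    _ = C ^ 2 * (‖y‖ ^ (2 * t) * ((1 + ‖y‖ ^ 2) ^ (s - i - t) * (‖y‖ ^ 2) ^ i) * ‖ft u y‖ ^ 2) := by
        ring
    _ ≤ _ := by gcongr

end

/-! ### Functions on `𝕊ⁿ⁻¹ × ℝ` -/

section Radon

variable {F G : Type*} [NormedAddCommGroup F] [NormedSpace ℂ F]
  [NormedAddCommGroup G] [NormedSpace ℂ G]

/-- The measure `(1/(2(2π)^{n-1})) |σ|^{2t} (1+σ²)^{s-t} dσ dω` on `𝕊ⁿ⁻¹ × ℝ`. -/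
def sphMeasure (n : ℕ) (s t : ℝ) : Measure (Sph n × ℝ) :=
  ENNReal.ofReal (1 / (2 * (2 * Real.pi) ^ (n - 1))) •
    ((volume : Measure (E n)).toSphere.prod
      (volume.withDensity fun σ => ENNReal.ofReal (wt s t σ)))

/-- The space `H^s_t(𝕊ⁿ⁻¹ × ℝ)` of `F`-valued functions `φ(ω,p)`. Its norm is
`‖φ‖² = (1/(2(2π)^{n-1})) ∫∫ |σ|^{2t} (1+σ²)^{s-t} |φ̂(ω,σ)|² dσ dω`, and an element `φ` is given by its
Fourier transform `φ̂(ω,σ)` in the variable `p`; all `φ̂` with finite norm occur. -/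
abbrev SphSob (n : ℕ) (s t : ℝ) (F : Type*) [NormedAddCommGroup F] : Type _ :=
  Lp F 2 (sphMeasure n s t)

/-- The target space `H^{s+(n-1)/2}_{t+(n-1)/2}(𝕊ⁿ⁻¹ × ℝ)` of Radon transforms on `H^s_t(ℝⁿ)`. -/
abbrev RadonSob (n : ℕ) (s t : ℝ) (F : Type*) [NormedAddCommGroup F] : Type _ :=
  SphSob n (s + ((n : ℝ) - 1) / 2) (t + ((n : ℝ) - 1) / 2) F

/-- The one-dimensional Fourier transform `ĝ(σ) = (2π)^{-1/2} ∫ e^{-ipσ} g(p) dp`. -/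
def ftp (g : ℝ → F) (σ : ℝ) : F :=
  (((2 * Real.pi) ^ (-(1 : ℝ) / 2) : ℝ) : ℂ) • ∫ p : ℝ, Complex.exp (-Complex.I * (p * σ : ℝ)) • g p

/-- The integral `∫_{ω^⊥} A_ω f(pω + y) dy` of `A_ω f` over the hyperplane `H_{ω,p}`. -/
def hyperInt (A : Sph n → F →L[ℂ] G) (f : E n → F) (ω : Sph n) (p : ℝ) : G :=
  ∫ y : (ℝ ∙ (ω : E n))ᗮ, A ω (f (p • (ω : E n) + y))

lemma measurePreserving_slice (ω : Sph n) :
    MeasurePreserving (fun z : ℝ × (ℝ ∙ (ω : E n))ᗮ => z.1 • (ω : E n) + (z.2 : E n)) := by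
  have hω : ‖(ω : E n)‖ = 1 := by simp
  have h1 := (LinearIsometryEquiv.toSpanUnitSingleton (𝕜 := ℝ) (ω : E n) hω).measurePreserving
  have h2 := (h1.prod (MeasurePreserving.id (volume : Measure (ℝ ∙ (ω : E n))ᗮ)))
  have h3 := WithLp.volume_preserving_toLp (ℝ ∙ (ω : E n)) (ℝ ∙ (ω : E n))ᗮ
  have h4 := ((ℝ ∙ (ω : E n)).orthogonalDecomposition).symm.measurePreserving
  have h5 : (fun z : ℝ × (ℝ ∙ (ω : E n))ᗮ => z.1 • (ω : E n) + (z.2 : E n)) =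
      (ℝ ∙ (ω : E n)).orthogonalDecomposition.symm ∘ WithLp.toLp 2 ∘
        Prod.map (LinearIsometryEquiv.toSpanUnitSingleton (𝕜 := ℝ) (ω : E n) hω) id := by
    funext z
    simp
  rw [h5]
  exact h4.comp (h3.comp h2)

lemma hyperInt_eq (A : Sph n → F →L[ℂ] G) [CompleteSpace F] [CompleteSpace G] (f : 𝓢(E n, F))
    (ω : Sph n) (σ : ℝ) :
    ftp (hyperInt A f ω) σ =
      (((2 * Real.pi) ^ (((n : ℝ) - 1) / 2) : ℝ) : ℂ) • A ω (ft f (σ • (ω : E n))) := by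
  have hω : ‖(ω : E n)‖ = 1 := by simp
  have hmp := measurePreserving_slice ω
  set g : E n → G := fun x => Complex.exp (-Complex.I * (inner ℝ x (σ • (ω : E n)) : ℝ)) • A ω (f x)
    with hg
  have hgc : Continuous g := by
    have := f.continuous
    fun_prop
  have hgi : Integrable g := by
    have : Integrable (fun x => ‖A ω (f x)‖) volume :=
      ((A ω).integrable_comp f.integrable).norm
    refine (integrable_norm_iff hgc.aestronglyMeasurable).1 ?_
    refine this.congr (ae_of_all _ fun x => ?_)
    simp [hg, norm_smul, Complex.norm_exp]
  have h1 : ∫ x, g x = ∫ p : ℝ, ∫ y : (ℝ ∙ (ω : E n))ᗮ, g (p • (ω : E n) + y) := by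
    rw [← hmp.map_eq, integral_map hmp.measurable.aemeasurable hgc.aestronglyMeasurable,
      Measure.volume_eq_prod, integral_prod]
    exact hmp.integrable_comp_of_integrable hgi
  have h2 : ∀ p : ℝ, ∫ y : (ℝ ∙ (ω : E n))ᗮ, g (p • (ω : E n) + y) =
      Complex.exp (-Complex.I * (p * σ : ℝ)) • hyperInt A f ω p := by
    intro p
    rw [hyperInt, ← integral_smul]
    refine integral_congr_ae (ae_of_all _ fun y => ?_)
    have hy : inner ℝ (y : E n) (ω : E n) = 0 := by
      rw [real_inner_comm]
      exact Submodule.mem_orthogonal_singleton_iff_inner_right.1 y.2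
    simp only [hg]
    congr 3
    rw [inner_smul_right, inner_add_left, inner_smul_left, hy, real_inner_self_eq_norm_sq, hω]
    simp [mul_comm]
  have h3 : A ω (ft f (σ • (ω : E n))) =
      (((2 * Real.pi) ^ (-(n : ℝ) / 2) : ℝ) : ℂ) • ∫ x, g x := by
    rw [ft_apply, map_smul, ← (A ω).integral_comp_comm]
    · simp [hg]
    · refine (integrable_norm_iff ?_).1 ?_
      · have := f.continuous
        exact Continuous.aestronglyMeasurable (by fun_prop)
      · refine f.integrable.norm.congr (ae_of_all _ fun x => ?_)
        simp [norm_smul, Complex.norm_exp]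
  rw [h3, smul_smul, h1, ftp]
  simp only [h2]
  congr 1
  rw [← Complex.ofReal_mul, ← Real.rpow_add (by positivity)]
  congr 2
  ring


/-- Integration in polar coordinates. -/
lemma lintegral_polar [NeZero n] {g : E n → ℝ≥0∞} (hg : Measurable g) :
    ∫⁻ y, g y = ∫⁻ ω : Sph n, ∫⁻ r in Set.Ioi (0 : ℝ),
      ENNReal.ofReal (r ^ (n - 1)) * g (r • (ω : E n)) ∂volume ∂(volume : Measure (E n)).toSphere := by
  have : Nontrivial (E n) := by
    have : Nonempty (Fin n) := ⟨0⟩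
    infer_instance
  have h1 : ∫⁻ y, g y = ∫⁻ x : ({0}ᶜ : Set (E n)), g (x : E n) ∂(volume.comap Subtype.val) := by
    rw [lintegral_subtype_comap (measurableSet_singleton _).compl g, restrict_compl_singleton]
  have hm : Measurable fun z : Sph n × Set.Ioi (0 : ℝ) => g ((z.2 : ℝ) • (z.1 : E n)) := by
    fun_prop
  have h2 := (volume : Measure (E n)).measurePreserving_homeomorphUnitSphereProd.lintegral_comp hm
  rw [h1]
  have h3 : ∫⁻ x : ({0}ᶜ : Set (E n)), g (x : E n) ∂(volume.comap Subtype.val) =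
      ∫⁻ z : Sph n × Set.Ioi (0 : ℝ), g ((z.2 : ℝ) • (z.1 : E n))
        ∂((volume : Measure (E n)).toSphere.prod
          (Measure.volumeIoiPow (Module.finrank ℝ (E n) - 1))) := by
    rw [← h2]
    refine lintegral_congr fun x => ?_
    have hx : ‖(x : E n)‖ ≠ 0 := norm_ne_zero_iff.2 x.2
    simp [smul_smul, hx]
  rw [h3, lintegral_prod _ hm.aemeasurable]
  refine lintegral_congr fun ω => ?_
  rw [Measure.volumeIoiPow, lintegral_withDensity_eq_lintegral_mul₀]
  · rw [← lintegral_subtype_comap measurableSet_Ioi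
      (fun r : ℝ => ENNReal.ofReal (r ^ (n - 1)) * g (r • (ω : E n)))]
    simp
  · fun_prop
  · fun_prop

/-- Integration over the sphere and the whole line. -/
lemma lintegral_sph_line [NeZero n] {g : E n → ℝ≥0∞} (hg : Measurable g) :
    ∫⁻ ω : Sph n, ∫⁻ r : ℝ, ENNReal.ofReal (|r| ^ (n - 1)) * g (r • (ω : E n))
      ∂volume ∂(volume : Measure (E n)).toSphere = 2 * ∫⁻ y, g y := by
  have hneg : ∫⁻ y, g (-y) = ∫⁻ y : E n, g y := lintegral_neg_eq_self g
  have hline : ∀ h : ℝ → ℝ≥0∞, ∫⁻ r, h r =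
      (∫⁻ r in Set.Ioi 0, h r) + ∫⁻ r in Set.Ioi 0, h (-r) := by
    intro h
    have e1 : ∫⁻ r in Set.Ioi 0, h (-r) = ∫⁻ r in Set.Iio 0, h r := by
      have := (Measure.measurePreserving_neg (volume : Measure ℝ)).setLIntegral_comp_preimage_emb
        (MeasurableEquiv.neg ℝ).measurableEmbedding h (Set.Iio 0)
      simpa using this
    rw [e1, add_comm, ← lintegral_add_compl h (measurableSet_Iio (a := (0 : ℝ))), Set.compl_Iio,
      setLIntegral_congr Ioi_ae_eq_Ici]
  have hmeas : ∀ g : E n → ℝ≥0∞, Measurable g → Measurable fun ω : Sph n =>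
      ∫⁻ r in Set.Ioi (0 : ℝ), ENNReal.ofReal (r ^ (n - 1)) * g (r • (ω : E n)) := by
    intro g hg
    refine Measurable.lintegral_prod_right ?_
    fun_prop
  rw [two_mul]
  nth_rewrite 2 [← hneg]
  rw [lintegral_polar hg, lintegral_polar (g := fun y => g (-y)) (by fun_prop),
    ← lintegral_add_left (hmeas g hg)]
  refine lintegral_congr fun ω => ?_
  rw [hline]
  congr 1
  · refine setLIntegral_congr_fun measurableSet_Ioi fun r hr => ?_
    simp only [abs_of_pos (show (0 : ℝ) < r from hr)]
  · refine setLIntegral_congr_fun measurableSet_Ioi fun r hr => ?_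
    simp only [abs_neg, abs_of_pos (show (0 : ℝ) < r from hr), neg_smul]



lemma eLpNorm_two_eq {α V : Type*} {_ : MeasurableSpace α} [NormedAddCommGroup V]
    (μ : Measure α) (g : α → V) : eLpNorm g 2 μ = (∫⁻ x, ‖g x‖ₑ ^ 2 ∂μ) ^ (1 / 2 : ℝ) := by
  rw [eLpNorm_eq_lintegral_rpow_enorm_toReal (by simp) (by simp)]
  simp

section

variable [NeZero n] (s t : ℝ)

lemma eLpNorm_slice_le (A : Sph n → F →L[ℂ] G) {C : ℝ} (hC : ∀ ω, ‖A ω‖ ≤ C) (f : 𝓢(E n, F)) :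
    eLpNorm (fun z : Sph n × ℝ => (((2 * Real.pi) ^ (((n : ℝ) - 1) / 2) : ℝ) : ℂ) •
        A z.1 (ft f (z.2 • (z.1 : E n)))) 2
      (sphMeasure n (s + ((n : ℝ) - 1) / 2) (t + ((n : ℝ) - 1) / 2)) ≤
    ENNReal.ofReal C * eLpNorm (ft f) 2 (sobMeasure n s t) := by
  have hn1 : ((n - 1 : ℕ) : ℝ) = (n : ℝ) - 1 := by
    rw [Nat.cast_sub NeZero.one_le]; simp
  have hsph : Nonempty (Sph n) := ⟨⟨EuclideanSpace.single 0 1, by simp⟩⟩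
  have hC0 : 0 ≤ C := (norm_nonneg _).trans (hC hsph.some)
  have hpi : (0 : ℝ) < 2 * Real.pi := by positivity
  set c : ℝ := (2 * Real.pi) ^ (((n : ℝ) - 1) / 2) with hc
  have hc2 : c ^ 2 = (2 * Real.pi) ^ (n - 1) := by
    rw [hc, ← Real.rpow_natCast, ← Real.rpow_mul hpi.le, ← Real.rpow_natCast, hn1]
    congr 1; push_cast; ring
  set H : E n → ℝ≥0∞ := fun y => ENNReal.ofReal (wt s t ‖y‖ * ‖ft f y‖ ^ 2) with hH
  have hHm : Measurable H := by
    have h1 := (measurable_wt s t).comp (measurable_norm (α := E n))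
    have h2 : Measurable fun y => ‖ft f y‖ := (ft f).continuous.norm.measurable
    exact (h1.mul (h2.pow_const 2)).ennreal_ofReal
  have hpt : ∀ (ω : Sph n) (σ : ℝ), σ ≠ 0 →
      ENNReal.ofReal (wt (s + ((n : ℝ) - 1) / 2) (t + ((n : ℝ) - 1) / 2) σ) *
        ‖(c : ℂ) • A ω (ft f (σ • (ω : E n)))‖ₑ ^ 2 ≤
      ENNReal.ofReal (c ^ 2 * C ^ 2) * (ENNReal.ofReal (|σ| ^ (n - 1)) * H (σ • (ω : E n))) := by
    intro ω σ hσ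
    have hσ' : 0 < |σ| := abs_pos.2 hσ
    rw [hH, ← ofReal_norm, ← ENNReal.ofReal_pow (norm_nonneg _),
      ← ENNReal.ofReal_mul (wt_nonneg _ _ _), ← ENNReal.ofReal_mul (by positivity),
      ← ENNReal.ofReal_mul (by positivity)]
    refine ENNReal.ofReal_le_ofReal ?_
    have h1 : ‖σ • (ω : E n)‖ = |σ| := by simp [norm_smul]
    have h2 : wt (s + ((n : ℝ) - 1) / 2) (t + ((n : ℝ) - 1) / 2) σ =
        |σ| ^ (n - 1) * wt s t |σ| := by
      rw [wt, wt, add_sub_add_right_eq_sub, abs_abs, sq_abs, ← Real.rpow_natCast _ (n - 1), hn1,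
        ← mul_assoc, ← Real.rpow_add hσ']
      congr 2; ring
    have h3 : ‖(c : ℂ) • A ω (ft f (σ • (ω : E n)))‖ ≤ c * (C * ‖ft f (σ • (ω : E n))‖) := by
      rw [norm_smul, Complex.norm_real, Real.norm_of_nonneg (by positivity)]
      gcongr
      exact (A ω).le_of_opNorm_le (hC ω) _
    rw [h1, h2]
    have := wt_nonneg s t |σ|
    calc _ ≤ |σ| ^ (n - 1) * wt s t |σ| * (c * (C * ‖ft f (σ • (ω : E n))‖)) ^ 2 := by gcongr
      _ = _ := by ring
  have hwm : Measurable fun σ : ℝ =>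
      ENNReal.ofReal (wt (s + ((n : ℝ) - 1) / 2) (t + ((n : ℝ) - 1) / 2) σ) :=
    (measurable_wt _ _).ennreal_ofReal
  have hJm : Measurable fun z : Sph n × ℝ =>
      ENNReal.ofReal (|z.2| ^ (n - 1)) * H (z.2 • (z.1 : E n)) := by fun_prop
  have hsq : ∫⁻ z : Sph n × ℝ, ‖(c : ℂ) • A z.1 (ft f (z.2 • (z.1 : E n)))‖ₑ ^ 2
      ∂(sphMeasure n (s + ((n : ℝ) - 1) / 2) (t + ((n : ℝ) - 1) / 2)) ≤
      ENNReal.ofReal (C ^ 2) * ∫⁻ y, ‖ft f y‖ₑ ^ 2 ∂(sobMeasure n s t) := by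
    have e1 : ∫⁻ y, ‖ft f y‖ₑ ^ 2 ∂(sobMeasure n s t) = ∫⁻ y, H y := by
      rw [sobMeasure, lintegral_withDensity_eq_lintegral_mul₀]
      · refine lintegral_congr fun y => ?_
        simp only [hH, Pi.mul_apply]
        rw [ENNReal.ofReal_mul (wt_nonneg _ _ _), ENNReal.ofReal_pow (norm_nonneg _), ofReal_norm]
      · exact ((measurable_wt s t).comp measurable_norm).ennreal_ofReal.aemeasurable
      · exact ((ft f).continuous.enorm.measurable.pow_const 2).aemeasurable
    have e2 : (volume : Measure (E n)).toSphere.prod (volume.withDensity fun σ : ℝ =>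
        ENNReal.ofReal (wt (s + ((n : ℝ) - 1) / 2) (t + ((n : ℝ) - 1) / 2) σ)) =
        ((volume : Measure (E n)).toSphere.prod (volume : Measure ℝ)).withDensity
          fun z => ENNReal.ofReal (wt (s + ((n : ℝ) - 1) / 2) (t + ((n : ℝ) - 1) / 2) z.2) := by
      rw [prod_withDensity_right hwm]
    have hne : ∀ᵐ z : Sph n × ℝ ∂((volume : Measure (E n)).toSphere.prod (volume : Measure ℝ)),
        z.2 ≠ 0 := by
      have : ∀ᵐ σ : ℝ, σ ≠ 0 := by simp [ae_iff]
      exact Measure.quasiMeasurePreserving_snd.ae this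
    rw [sphMeasure, lintegral_smul_measure, e2, e1]
    calc _ ≤ ENNReal.ofReal (1 / (2 * (2 * Real.pi) ^ (n - 1))) *
          ∫⁻ z : Sph n × ℝ, ENNReal.ofReal (c ^ 2 * C ^ 2) *
            (ENNReal.ofReal (|z.2| ^ (n - 1)) * H (z.2 • (z.1 : E n)))
            ∂((volume : Measure (E n)).toSphere.prod (volume : Measure ℝ)) := by
          rw [smul_eq_mul]
          refine mul_le_mul' le_rfl ?_
          refine (lintegral_withDensity_le_lintegral_mul _ (hwm.comp measurable_snd) _).trans ?_
          refine lintegral_mono_ae ?_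
          filter_upwards [hne] with z hz
          exact hpt z.1 z.2 hz
      _ = ENNReal.ofReal (1 / (2 * (2 * Real.pi) ^ (n - 1))) * (ENNReal.ofReal (c ^ 2 * C ^ 2) *
            (2 * ∫⁻ y, H y)) := by
          rw [lintegral_const_mul _ hJm, lintegral_prod _ hJm.aemeasurable, lintegral_sph_line hHm]
      _ = _ := by
          have h2 : (2 : ℝ≥0∞) * ∫⁻ y, H y = ENNReal.ofReal 2 * ∫⁻ y, H y := by simp
          rw [h2, ← mul_assoc, ← mul_assoc,
            ← ENNReal.ofReal_mul (by positivity), ← ENNReal.ofReal_mul (by positivity), hc2]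
          congr 2
          field_simp
  rw [eLpNorm_two_eq, eLpNorm_two_eq]
  calc _ ≤ (ENNReal.ofReal (C ^ 2) * ∫⁻ y, ‖ft f y‖ₑ ^ 2 ∂(sobMeasure n s t)) ^ (1 / 2 : ℝ) := by
        gcongr
    _ = _ := by
        rw [ENNReal.mul_rpow_of_nonneg _ _ (by norm_num), ENNReal.ofReal_rpow_of_nonneg
          (by positivity) (by norm_num)]
        congr 2
        rw [← Real.sqrt_eq_rpow, Real.sqrt_sq hC0]

end

section

variable [NeZero n] (s t : ℝ) [CompleteSpace F] [CompleteSpace G]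

lemma memLp_hyperInt [Fact (-(n : ℝ) / 2 < t)] {A : Sph n → F →L[ℂ] G} (hA : StronglyMeasurable A)
    (hC : ∃ C, ∀ ω, ‖A ω‖ ≤ C) (f : 𝓢(E n, F)) :
    MemLp (fun z : Sph n × ℝ => ftp (hyperInt A f z.1) z.2) 2
      (sphMeasure n (s + ((n : ℝ) - 1) / 2) (t + ((n : ℝ) - 1) / 2)) := by
  obtain ⟨C, hC⟩ := hC
  simp only [hyperInt_eq]
  refine ⟨?_, (eLpNorm_slice_le s t A hC f).trans_lt ?_⟩
  · have h1 : StronglyMeasurable fun z : Sph n × ℝ => ft f (z.2 • (z.1 : E n)) :=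
      ((ft f).continuous.comp (by fun_prop)).stronglyMeasurable
    have h2 : StronglyMeasurable fun z : Sph n × ℝ => A z.1 (ft f (z.2 • (z.1 : E n))) :=
      (isBoundedBilinearMap_apply (𝕜 := ℂ) (E := F) (F := G)).continuous.comp_stronglyMeasurable
        ((hA.comp_measurable measurable_fst).prodMk h1)
    exact (h2.const_smul _).aestronglyMeasurable
  · exact ENNReal.mul_lt_top ENNReal.ofReal_lt_top ((ft f).memLp 2 (sobMeasure n s t)).2

/-- The transform `f ↦ ((ω, p) ↦ ∫_{ω^⊥} A_ω f(pω + y) dy)` on Schwartz functions. -/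
def radonL [Fact (-(n : ℝ) / 2 < t)] (A : Sph n → F →L[ℂ] G) (hA : StronglyMeasurable A)
    (hC : ∃ C, ∀ ω, ‖A ω‖ ≤ C) : 𝓢(E n, F) →ₗ[ℂ] RadonSob n s t G where
  toFun f := (memLp_hyperInt s t hA hC f).toLp
  map_add' f g := by
    rw [← MemLp.toLp_add]
    congr 1
    funext z
    rw [Pi.add_apply, hyperInt_eq, hyperInt_eq, hyperInt_eq, map_add, add_apply, map_add, smul_add]
  map_smul' c f := by
    rw [RingHom.id_apply, ← MemLp.toLp_const_smul]
    congr 1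
    funext z
    rw [Pi.smul_apply, hyperInt_eq, hyperInt_eq, map_smul ft c f, smul_apply, map_smul (A z.1) c, smul_comm c]

/-- The continuous extension of `radonL` to `H^s_t`, see `radonH_toSob`. -/
def radonH [Fact (-(n : ℝ) / 2 < t)] (A : Sph n → F →L[ℂ] G) (hA : StronglyMeasurable A)
    (hC : ∃ C, ∀ ω, ‖A ω‖ ≤ C) : Sob n s t F →L[ℂ] RadonSob n s t G :=
  (radonL s t A hA hC).extendOfNorm (toSob n s t F)

lemma radonH_toSob [Fact (-(n : ℝ) / 2 < t)] (A : Sph n → F →L[ℂ] G) (hA : StronglyMeasurable A)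
    (hC : ∃ C, ∀ ω, ‖A ω‖ ≤ C) (f : 𝓢(E n, F)) :
    radonH s t A hA hC (toSob n s t F f) = radonL s t A hA hC f := by
  refine LinearMap.extendOfNorm_eq (denseRange_toSob _ _) ?_ f
  obtain ⟨C, hC'⟩ := hC
  have hsph : Nonempty (Sph n) := ⟨⟨EuclideanSpace.single 0 1, by simp⟩⟩
  have hC0 : 0 ≤ C := (norm_nonneg _).trans (hC' hsph.some)
  refine ⟨C, fun f => ?_⟩
  have h := eLpNorm_slice_le s t A hC' f
  rw [norm_toSob_eq]
  change ‖(memLp_hyperInt s t hA ⟨C, hC'⟩ f).toLp‖ ≤ _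
  rw [Lp.norm_toLp]
  simp only [hyperInt_eq]
  refine (ENNReal.toReal_mono ?_ h).trans ?_
  · exact (ENNReal.mul_lt_top ENNReal.ofReal_lt_top ((ft f).memLp 2 (sobMeasure n s t)).2).ne
  · rw [ENNReal.toReal_mul, ENNReal.toReal_ofReal hC0]

/-- The componentwise Radon transform `R̄`: the continuous extension of
`f ↦ ∫_{ω^⊥} f(pω + y) dy` from Schwartz fields, see `hyperInt_id_comp`. -/
def radonBar [Fact (-(n : ℝ) / 2 < t)] : Sob n s t F →L[ℂ] RadonSob n s t F :=
  radonH s t (fun _ => ContinuousLinearMap.id ℂ F) stronglyMeasurable_const ⟨_, fun _ => le_rfl⟩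

end

lemma integrable_slice (f : 𝓢(E n, F)) (ω : Sph n) (p : ℝ) :
    Integrable fun y : (ℝ ∙ (ω : E n))ᗮ => f (p • (ω : E n) + y) := by
  have h1 : (fun y : (ℝ ∙ (ω : E n))ᗮ => p • (ω : E n) + (y : E n)).HasTemperateGrowth :=
    (Function.HasTemperateGrowth.const _).add
      ((ℝ ∙ (ω : E n))ᗮ.subtypeL).hasTemperateGrowth
  have h2 : AntilipschitzWith 1 fun y : (ℝ ∙ (ω : E n))ᗮ => p • (ω : E n) + (y : E n) := by
    refine AntilipschitzWith.of_le_mul_dist fun x y => ?_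
    simp [dist_eq_norm]
  exact (SchwartzMap.compCLMOfAntilipschitz ℝ h1 h2 f).integrable

/-! ### The derivative in `p` -/

lemma ftp_iteratedDeriv (g : 𝓢(ℝ, F)) (i : ℕ) (σ : ℝ) :
    ftp (iteratedDeriv i g) σ = (Complex.I * σ) ^ i • ftp g σ := by
  have h : ∀ g : ℝ → F, ftp g σ =
      (((2 * Real.pi) ^ (-(1 : ℝ) / 2) : ℝ) : ℂ) • 𝓕 g ((2 * Real.pi)⁻¹ * σ) := by
    intro g
    rw [ftp, Real.fourier_real_eq_integral_exp_smul]
    congr 1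
    refine integral_congr_ae (ae_of_all _ fun p => ?_)
    simp only
    congr 2
    push_cast
    have : (Real.pi : ℂ) ≠ 0 := by exact_mod_cast Real.pi_ne_zero
    field_simp
  rw [h, h, Real.fourier_iteratedDeriv (N := ⊤) (g.smooth ⊤) _ le_top, smul_comm]
  · congr 2
    push_cast
    have : (Real.pi : ℂ) ≠ 0 := by exact_mod_cast Real.pi_ne_zero
    field_simp
  · intro k _
    have := (g.integrable_pow_mul_iteratedFDeriv volume 0 k)
    refine (integrable_norm_iff ?_).1 ?_
    · exact ((g.smooth ⊤).continuous_iteratedDeriv k (mod_cast le_top)).aestronglyMeasurable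
    · refine this.congr (ae_of_all _ fun x => ?_)
      simp [norm_iteratedFDeriv_eq_norm_iteratedDeriv]

lemma lintegral_sphMeasure (s t : ℝ) {h : Sph n × ℝ → ℝ≥0∞} (hh : Measurable h) :
    ∫⁻ z, h z ∂(sphMeasure n s t) = ENNReal.ofReal (1 / (2 * (2 * Real.pi) ^ (n - 1))) *
      ∫⁻ z, ENNReal.ofReal (wt s t z.2) * h z ∂((volume : Measure (E n)).toSphere.prod volume) := by
  have hwm : Measurable fun σ : ℝ => ENNReal.ofReal (wt s t σ) := (measurable_wt _ _).ennreal_ofReal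
  have hwm' : Measurable fun z : Sph n × ℝ => ENNReal.ofReal (wt s t z.2) := hwm.comp measurable_snd
  rw [sphMeasure, lintegral_smul_measure, prod_withDensity_right hwm,
    lintegral_withDensity_eq_lintegral_mul _ hwm' hh]
  rfl

lemma memLp_Dp [NeZero n] (s t : ℝ) (i : ℕ) (φ : RadonSob n s t F) :
    MemLp (fun z : Sph n × ℝ => (Complex.I * z.2) ^ i • φ z) 2
      (sphMeasure n (s - i + ((n : ℝ) - 1) / 2) (t + ((n : ℝ) - 1) / 2)) := by
  have hφ : StronglyMeasurable φ := Lp.stronglyMeasurable φ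
  have hg : StronglyMeasurable fun z : Sph n × ℝ => (Complex.I * z.2) ^ i • φ z := by
    have : Continuous fun z : Sph n × ℝ => (Complex.I * z.2) ^ i := by fun_prop
    exact this.stronglyMeasurable.smul hφ
  refine ⟨hg.aestronglyMeasurable, lt_of_le_of_lt ?_ (Lp.memLp φ).2⟩
  rw [eLpNorm_two_eq, eLpNorm_two_eq, lintegral_sphMeasure _ _ (hg.enorm.pow_const 2),
    lintegral_sphMeasure _ _ (hφ.enorm.pow_const 2)]
  refine ENNReal.rpow_le_rpow (mul_le_mul' le_rfl (lintegral_mono fun z => ?_)) (by norm_num)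
  rw [← ofReal_norm, ← ofReal_norm, ← ENNReal.ofReal_pow (norm_nonneg _),
    ← ENNReal.ofReal_pow (norm_nonneg _), ← ENNReal.ofReal_mul (wt_nonneg _ _ _),
    ← ENNReal.ofReal_mul (wt_nonneg _ _ _)]
  refine ENNReal.ofReal_le_ofReal ?_
  have h1 : (0 : ℝ) < 1 + z.2 ^ 2 := by positivity
  have h2 : (1 + z.2 ^ 2) ^ (s - t) = (1 + z.2 ^ 2) ^ (s - i - t) * (1 + z.2 ^ 2) ^ i := by
    rw [← Real.rpow_natCast _ i, ← Real.rpow_add h1]; congr 1; ring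
  have h3 : (z.2 ^ 2) ^ i ≤ (1 + z.2 ^ 2) ^ i := by gcongr; linarith
  rw [wt, wt, add_sub_add_right_eq_sub, add_sub_add_right_eq_sub, h2, norm_smul]
  simp only [norm_pow, norm_mul, Complex.norm_I, one_mul, Complex.norm_real, Real.norm_eq_abs]
  calc _ = |z.2| ^ (2 * (t + ((n : ℝ) - 1) / 2)) * ((1 + z.2 ^ 2) ^ (s - i - t) * (z.2 ^ 2) ^ i) *
        ‖φ z‖ ^ 2 := by rw [← sq_abs z.2]; ring
    _ ≤ _ := by gcongr

/-- The operator `∂^i/∂p^i : H^{s}_{t}(𝕊ⁿ⁻¹ × ℝ) → H^{s-i}_{t}(𝕊ⁿ⁻¹ × ℝ)` (the indices being shifted by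
`(n-1)/2`), which is multiplication by `(iσ)^i` on the Fourier side, see `ftp_iteratedDeriv`. -/
def Dp [NeZero n] {s t : ℝ} (i : ℕ) (φ : RadonSob n s t F) : RadonSob n (s - i) t F :=
  (memLp_Dp s t i φ).toLp

end Radon

/-! ### Frames and generalized Radon transforms -/

/-- A measurable choice of an orthonormal basis `ω₁, …, ω_{n-1}` of `ω^⊥` for `ω ∈ 𝕊ⁿ⁻¹`. -/
structure Frame (n : ℕ) where
  /-- The vectors `ω₁, …, ω_{n-1}`. -/
  vec : Sph n → Fin (n - 1) → E n
  measurable_vec : ∀ j, Measurable fun ω => vec ω j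
  orthonormal_vec : ∀ ω, Orthonormal ℝ (vec ω)
  inner_vec : ∀ ω j, inner ℝ (vec ω j) (ω : E n) = 0

/-- The symmetric tensor `ω₁^{⊙ℓ₁} ⊙ ⋯ ⊙ ω_{n-1}^{⊙ℓ_{n-1}} ⊙ ω^{⊙k}`. -/
def Frame.tensor (e : Frame n) (ℓ : Fin (n - 1) → ℕ) (k : ℕ) (ω : Sph n) : SymT n m :=
  symPow (fun o : Option (Fin (n - 1)) => o.elim (ω : E n) (e.vec ω)) (fun o => o.elim k ℓ)

lemma Frame.stronglyMeasurable_tensor (e : Frame n) (ℓ : Fin (n - 1) → ℕ) (k : ℕ) :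
    StronglyMeasurable fun ω => pairing (e.tensor ℓ k ω : SymT n m) := by
  have hb : ∀ (o : Option (Fin (n - 1))) (i : Fin n), Measurable fun ω : Sph n =>
      (((o.elim (ω : E n) (e.vec ω) : E n) i : ℝ) : ℂ) := by
    intro o i
    have hi : Measurable fun x : E n => ((x i : ℝ) : ℂ) := by
      have : Continuous fun x : E n => ((x i : ℝ) : ℂ) := by fun_prop
      exact this.measurable
    cases o with
    | none => exact hi.comp measurable_subtype_coe
    | some j => exact hi.comp (e.measurable_vec j)
  unfold pairing
  refine Finset.stronglyMeasurable_fun_sum _ fun I _ => ?_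
  refine StronglyMeasurable.smul_const (Measurable.stronglyMeasurable ?_) _
  simp only [Frame.tensor, symPow, SymT.comp_mk]
  refine Measurable.const_mul ?_ _
  exact Finset.measurable_fun_sum _ fun J _ => Finset.measurable_fun_prod _ fun r _ => hb _ _

lemma Frame.bounded_tensor (e : Frame n) (ℓ : Fin (n - 1) → ℕ) (k : ℕ) :
    ∃ C, ∀ ω, ‖pairing (e.tensor ℓ k ω : SymT n m)‖ ≤ C := by
  refine ⟨∑ I : Fin m → Fin n, (‖(∏ j : Option (Fin (n - 1)), ((j.elim k ℓ).factorial : ℂ)) /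
    (m.factorial : ℂ)‖ * ∑ J : Fin m → Option (Fin (n - 1)) with
      ∀ j, (Finset.univ.filter fun r => J r = j).card = j.elim k ℓ, 1) *
    ‖(compL I : SymT n m →L[ℂ] ℂ)‖, fun ω => ?_⟩
  have hb : ∀ (o : Option (Fin (n - 1))) (i : Fin n),
      ‖(((o.elim (ω : E n) (e.vec ω) : E n) i : ℝ) : ℂ)‖ ≤ 1 := by
    intro o i
    rw [Complex.norm_real]
    refine (PiLp.norm_apply_le _ i).trans ?_
    cases o with
    | none => simp
    | some j => exact ((e.orthonormal_vec ω).1 j).le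
  refine norm_sum_le_of_le _ fun I _ => ?_
  rw [norm_smul]
  gcongr
  simp only [Frame.tensor, symPow, SymT.comp_mk]
  rw [norm_mul]
  gcongr
  refine norm_sum_le_of_le _ fun J _ => ?_
  rw [norm_prod]
  exact Finset.prod_le_one (fun _ _ => norm_nonneg _) fun r _ => hb _ _

/-- The generalized Radon transform `R^m_{ℓ₁…ℓ_{n-1} k}` on `H^s_t(S^m ℝⁿ)`: the continuous extension
of `f ↦ ∫_{ω^⊥} ⟨f(pω + y), ω₁^{⊙ℓ₁} ⊙ ⋯ ⊙ ω_{n-1}^{⊙ℓ_{n-1}} ⊙ ω^{⊙k}⟩ dy` from Schwartz fields, see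
`coeFn_grt_toSob`. -/
def grt [NeZero n] (s t : ℝ) [Fact (-(n : ℝ) / 2 < t)] (m : ℕ) (e : Frame n)
    (ℓ : Fin (n - 1) → ℕ) (k : ℕ) : Sob n s t (SymT n m) →L[ℂ] RadonSob n s t ℂ :=
  radonH s t (fun ω => pairing (e.tensor ℓ k ω)) (e.stronglyMeasurable_tensor ℓ k)
    (e.bounded_tensor ℓ k)

lemma coeFn_grt_toSob [NeZero n] (s t : ℝ) [Fact (-(n : ℝ) / 2 < t)] (e : Frame n)
    (ℓ : Fin (n - 1) → ℕ) (k : ℕ) (f : 𝓢(E n, SymT n m)) :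
    grt s t m e ℓ k (toSob n s t _ f)
      =ᵐ[sphMeasure n (s + ((n : ℝ) - 1) / 2) (t + ((n : ℝ) - 1) / 2)]
    fun z => ftp (fun p => ∫ y : (ℝ ∙ (z.1 : E n))ᗮ, pairing (e.tensor ℓ k z.1)
      (f (p • (z.1 : E n) + y))) z.2 := by
  rw [grt, radonH_toSob]
  exact MemLp.coeFn_toLp
    (memLp_hyperInt s t (e.stronglyMeasurable_tensor ℓ k) (e.bounded_tensor ℓ k) f)

lemma hyperInt_id_comp (f : 𝓢(E n, SymT n m)) (ω : Sph n) (p : ℝ) (I : Fin m → Fin n) :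
    (hyperInt (fun _ => ContinuousLinearMap.id ℂ (SymT n m)) f ω p).comp I =
      ∫ y : (ℝ ∙ (ω : E n))ᗮ, (f (p • (ω : E n) + y)).comp I :=
  ((compL I).integral_comp_comm (integrable_slice f ω p)).symm

instance (n : ℕ) [NeZero n] : Nonempty (Frame n) := by
  have hlast : n - 1 < n := Nat.sub_lt (NeZero.pos n) one_pos
  set a : E n := stdE ⟨n - 1, hlast⟩ with ha
  have hna : ‖a‖ = 1 := by simp [ha]
  have hR : ∀ ω : Sph n, (ℝ ∙ (a - (ω : E n)))ᗮ.reflection a = ω := fun ω =>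
    Submodule.reflection_sub (by simp [hna])
  have hinj : Function.Injective (Fin.castLE (Nat.sub_le n 1)) := Fin.castLE_injective _
  have hon : Orthonormal ℝ fun j : Fin n => (stdE j : E n) :=
    EuclideanSpace.orthonormal_single
  refine ⟨⟨fun ω j => (ℝ ∙ (a - (ω : E n)))ᗮ.reflection (stdE (j.castLE (Nat.sub_le n 1))), ?_, ?_, ?_⟩⟩
  · intro j
    set b : E n := stdE (j.castLE (Nat.sub_le n 1))
    have hd : Measurable fun ω : Sph n => a - (ω : E n) := by fun_prop
    have hc : Measurable fun ω : Sph n => inner ℝ (a - (ω : E n)) b / ‖a - (ω : E n)‖ ^ 2 :=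
      (hd.inner measurable_const).div (hd.norm.pow_const 2)
    have h : (fun ω : Sph n => (ℝ ∙ (a - (ω : E n)))ᗮ.reflection b) = fun ω : Sph n =>
        -((2 : ℝ) • (inner ℝ (a - (ω : E n)) b / ‖a - (ω : E n)‖ ^ 2) • (a - (ω : E n)) - b) := by
      funext ω
      rw [Submodule.reflection_orthogonal_apply, Submodule.reflection_singleton_apply, two_smul,
        two_smul]
      rfl
    rw [h]
    exact (((hc.smul hd).const_smul (2 : ℝ)).sub_const b).neg
  · exact fun ω => (hon.comp _ hinj).comp_linearIsometryEquiv _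
  · intro ω j
    have hne : j.castLE (Nat.sub_le n 1) ≠ (⟨n - 1, hlast⟩ : Fin n) := fun h =>
      absurd (congrArg Fin.val h) (Nat.ne_of_lt j.2)
    have h : inner ℝ (stdE (j.castLE (Nat.sub_le n 1))) (stdE (⟨n - 1, hlast⟩ : Fin n)) = (0 : ℝ) :=
      hon.2 hne
    rw [← LinearIsometryEquiv.inner_map_map ((ℝ ∙ (a - (ω : E n)))ᗮ.reflection)] at h
    rwa [show stdE (⟨n - 1, hlast⟩ : Fin n) = a from rfl, hR ω] at h

/-! ### Decomposition -/

/-- A tensor field `u ∈ H^s_t(S^k ℝⁿ)` is solenoidal if `δu = 0`; fields of degree `0` always are. -/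
def IsSolenoidal [NeZero n] {s t : ℝ} [Fact (-(n : ℝ) / 2 < t)] {k : ℕ}
    (u : Sob n s t (SymT n k)) : Prop :=
  ∀ (j : ℕ) (h : j + 1 = k), divH s t 1 h u = 0

/-- `f = ∑_{i=0}^m d^i v_i` with `v_i ∈ H^{s+i}_{t+i}(S^{m-i} ℝⁿ)` solenoidal for `i < m`. -/
structure IsDecomposition [NeZero n] {s t : ℝ} [Fact (-(n : ℝ) / 2 < t)] {m : ℕ}
    (f : Sob n s t (SymT n m))
    (v : ∀ i : Fin (m + 1), Sob n (s + (i : ℕ)) (t + (i : ℕ)) (SymT n (m - i))) : Prop where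
  sum_eq : f = ∑ i : Fin (m + 1), dH s t i (Nat.sub_add_cancel (Nat.le_of_lt_succ i.2)) (v i)
  solenoidal : ∀ i : Fin (m + 1), (i : ℕ) < m → IsSolenoidal (v i)

end TensorRadon

end

/-! The proof is pointwise linear algebra on the Fourier side. At frequency y the operator d is i
times T ↦ T ⊙ y (`symMul`) and δ is i times the contraction ι_y (`contract`). By the slice theorem
(`coeFn_radonH`), the Fourier transform in p of a Radon transform of f at (ω, σ) is a constant times
the pairing of f̂(σω) with the frame tensor at ω. So f = ∑ d^j v_j means f̂(y) = ∑ i^j V_j ⊙ y^j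
with V_j = v̂_j(y), and solenoidality means ι_y V_j = 0.

The maps ⊙ y and ι_y are adjoint, and ι_y(T ⊙ y) is a convex combination of |y|² T and (ι_y T) ⊙ y
(`contract_symMul_succ`). Two things follow. First, ι_y(· ⊙ y) is invertible for y ≠ 0, with bounds
homogeneous in y. Removing factors of y one after another therefore decomposes any tensor
(`sum_mulPow_component`). The i-th component costs |y|^{-i}, exactly the gain between H^s_t and
H^{s+i}_{t+i} (`memLp_component`), and the Fourier transform maps H^s_t onto the weighted L² space
(`hat_surjective`), so the v_i exist.

Second, apply ι_y i times to V_j ⊙ y^j. For j < i the result is 0; for j = i it is a positive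
multiple of |y|^{2i} V_i; for j > i a factor y survives, and the result vanishes on vectors
orthogonal to y. Pairing f̂(σω) with i copies of ω and m - i vectors of ω^⊥ thus sees only V_i
(`eval_conPow_sum`). A tensor annihilated by ι_ω is the multinomial sum of its values on the frame
(`Frame.sum_multinomial_smul_symPow`), which gives the formula for R̄(δ^i d^i v_i), the factor
(iσ)^i being ∂_p^i. As R̄ is injective and δ^i d^i acts on V_i by a nonzero scalar, the data
determine v_i; with equal data on both sides this is also the uniqueness of the decomposition. -/

noncomputable section

namespace TensorRadon

variable {n m k : ℕ}

/-! ### Symmetric multiplication and contraction -/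

/-- The symmetric product `T ↦ T ⊙ y`. -/
def symMul (y : E n) : SymT n m →L[ℂ] SymT n (m + 1) := ∑ j, ((y j : ℝ) : ℂ) • symMulE j

/-- The contraction `T ↦ ι_y T` of the last index with `y`. -/
def contract (y : E n) : SymT n (m + 1) →L[ℂ] SymT n m := ∑ j, ((y j : ℝ) : ℂ) • contractE j

/-- The sum does not depend on `a`, by composing with a transposition; summing over all `a` counts
every `f r` exactly (m+1)! times, and one divides by m+1. -/
lemma sum_perm_apply {M : Type*} [AddCommGroup M] [Module ℂ M] (f : Fin (m + 1) → M)
    (a : Fin (m + 1)) :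
    ∑ π : Equiv.Perm (Fin (m + 1)), f (π a) = (m.factorial : ℂ) • ∑ r, f r := by
  have h1 : ∀ b, ∑ π : Equiv.Perm (Fin (m + 1)), f (π b) =
      ∑ π : Equiv.Perm (Fin (m + 1)), f (π a) := fun b =>
    Fintype.sum_equiv (Equiv.mulRight (Equiv.swap a b)) _ _ fun π => by simp
  have h2 : ∑ b : Fin (m + 1), ∑ π : Equiv.Perm (Fin (m + 1)), f (π b) =
      ((m + 1).factorial : ℂ) • ∑ r, f r := by
    rw [Finset.sum_comm, Finset.sum_congr rfl fun π _ => Equiv.sum_comp π f]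
    simp [Fintype.card_perm, Nat.cast_smul_eq_nsmul ℂ]
  rw [Finset.sum_congr rfl fun b _ => h1 b, Finset.sum_const, Finset.card_univ, Fintype.card_fin,
    ← Nat.cast_smul_eq_nsmul ℂ, Nat.factorial_succ, Nat.cast_mul, mul_smul] at h2
  exact smul_right_injective _ (by exact_mod_cast Nat.succ_ne_zero m) h2

/-- Dropping the last entry of `I ∘ π` leaves the entries of `I` other than the one at `π (Fin.last
m)`, in some order `ρ` that a symmetric tensor does not see. -/
lemma SymT.comp_init_perm (T : SymT n m) (I : Fin (m + 1) → Fin n)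
    (π : Equiv.Perm (Fin (m + 1))) :
    T.comp (Fin.init (I ∘ π)) = T.comp (I ∘ (π (Fin.last m)).succAbove) := by
  have h : ∀ r : Fin m, ∃ r', (π (Fin.last m)).succAbove r' = π r.castSucc := fun r =>
    Fin.exists_succAbove_eq fun h => (Fin.castSucc_lt_last r).ne (π.injective h)
  choose ρ hρ using h
  have hinj : Function.Injective ρ := fun a b hab => by
    have : π a.castSucc = π b.castSucc := by rw [← hρ, ← hρ, hab]
    exact Fin.castSucc_injective _ (π.injective this)
  rw [← T.comp_perm (Equiv.ofBijective ρ (Finite.injective_iff_bijective.1 hinj))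
    (I ∘ (π (Fin.last m)).succAbove)]
  congr 1
  funext r
  simp [Fin.init, hρ]

/-- A term of the symmetrization depends only on the slot that receives y, so the (m+1)!
permutations collapse to an average over m+1 slots. -/
lemma symMul_comp (y : E n) (T : SymT n m) (I : Fin (m + 1) → Fin n) :
    (symMul y T).comp I =
      ((m + 1 : ℕ) : ℂ)⁻¹ * ∑ r, ((y (I r) : ℝ) : ℂ) * T.comp (I ∘ r.succAbove) := by
  have h1 : (symMul y T).comp I = ((m + 1).factorial : ℂ)⁻¹ *
      ∑ π : Equiv.Perm (Fin (m + 1)), ((y (I (π (Fin.last m))) : ℝ) : ℂ) *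
        T.comp (Fin.init (I ∘ π)) := by
    rw [symMul, sum_apply, SymT.comp_sum]
    simp only [smul_apply, SymT.comp_smul, symMulE, LinearMap.coe_toContinuousLinearMap',
      LinearMap.comp_apply, symmetrize, LinearMap.coe_mk, AddHom.coe_mk, SymT.comp_mk,
      Function.comp_apply]
    simp_rw [mul_left_comm _ ((m + 1).factorial : ℂ)⁻¹]
    rw [← Finset.mul_sum]
    simp_rw [Finset.mul_sum]
    rw [Finset.sum_comm]
    simp
  rw [h1]
  simp_rw [SymT.comp_init_perm]
  rw [sum_perm_apply (fun r => ((y (I r) : ℝ) : ℂ) * T.comp (I ∘ r.succAbove)) (Fin.last m),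
    smul_eq_mul, Nat.factorial_succ, ← mul_assoc]
  have := Nat.factorial_ne_zero m
  congr 1
  push_cast
  field_simp

lemma contract_comp (y : E n) (T : SymT n (m + 1)) (I : Fin m → Fin n) :
    (contract y T).comp I = ∑ j, ((y j : ℝ) : ℂ) * T.comp (Fin.snoc I j : Fin (m + 1) → Fin n) := by
  rw [contract, sum_apply, SymT.comp_sum]
  rfl

lemma sum_coord_mul_self (y : E n) :
    ∑ j, ((y j : ℝ) : ℂ) * ((y j : ℝ) : ℂ) = ((‖y‖ ^ 2 : ℝ) : ℂ) := by
  rw [EuclideanSpace.real_norm_sq_eq]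
  push_cast
  simp [sq]

/-- When y occupies the contracted slot it contributes |y|²; otherwise the contraction falls on T.
The second sum is left in indices because ι_y T is defined only in positive degree, where the lemmas
below treat the two cases. -/
lemma contract_symMul_comp (y : E n) (T : SymT n m) (I : Fin m → Fin n) :
    (contract y (symMul y T)).comp I = ((m + 1 : ℕ) : ℂ)⁻¹ * (((‖y‖ ^ 2 : ℝ) : ℂ) * T.comp I +
      ∑ r : Fin m, ((y (I r) : ℝ) : ℂ) * ∑ j, ((y j : ℝ) : ℂ) *
        T.comp ((Fin.snoc I j : Fin (m + 1) → Fin n) ∘ r.castSucc.succAbove)) := by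
  rw [contract_comp]
  simp_rw [symMul_comp, Fin.sum_univ_castSucc, Fin.snoc_last, Fin.snoc_castSucc]
  have hl : ∀ j, (Fin.snoc I j : Fin (m + 1) → Fin n) ∘ (Fin.last m).succAbove = I := fun j => by
    funext r; simp
  simp_rw [hl, mul_left_comm _ ((m + 1 : ℕ) : ℂ)⁻¹]
  rw [← Finset.mul_sum, ← sum_coord_mul_self, Finset.sum_mul]
  congr 1
  simp_rw [mul_add, Finset.sum_add_distrib, Finset.mul_sum]
  rw [add_comm, Finset.sum_comm]
  congr 1
  · exact Finset.sum_congr rfl fun j _ => by ring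
  · exact Finset.sum_congr rfl fun r _ => Finset.sum_congr rfl fun j _ => by ring

lemma contract_symMul_zero (y : E n) (T : SymT n 0) :
    contract y (symMul y T) = ((‖y‖ ^ 2 : ℝ) : ℂ) • T := by
  refine SymT.ext fun I => ?_
  rw [contract_symMul_comp]
  simp [SymT.comp_smul]

/-- The commutation relation between ⊙ y and ι_y, on which all the later algebra rests. -/
lemma contract_symMul_succ (y : E n) (T : SymT n (m + 1)) :
    contract y (symMul y T) = ((m + 2 : ℕ) : ℂ)⁻¹ • (((‖y‖ ^ 2 : ℝ) : ℂ) • T +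
      ((m + 1 : ℕ) : ℂ) • symMul y (contract y T)) := by
  refine SymT.ext fun I => ?_
  rw [contract_symMul_comp]
  simp only [SymT.comp_smul, SymT.comp_add, symMul_comp, contract_comp]
  have h : ((m + 1 : ℕ) : ℂ) ≠ 0 := by exact_mod_cast Nat.succ_ne_zero m
  rw [mul_inv_cancel_left₀ h]
  congr 2
  refine Finset.sum_congr rfl fun r _ => ?_
  congr 1
  refine Finset.sum_congr rfl fun j _ => ?_
  congr 2
  funext q
  refine Fin.lastCases ?_ (fun q => ?_) q <;> simp

/-- The Hermitian product of the components. -/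
lemma sum_symMul_mul_star (y : E n) (T : SymT n m) (S : SymT n (m + 1)) :
    ∑ I, (symMul y T).comp I * star (S.comp I) = ∑ I, T.comp I * star ((contract y S).comp I) := by
  -- By symmetry of `S` the slot into which `j` is inserted is immaterial. Hence the m+1 slots give
  -- equal sums, and these cancel the factor 1/(m+1).
  have hS : ∀ (r : Fin (m + 1)) (I : Fin m → Fin n) (j : Fin n),
      S.comp (r.insertNth j I : Fin (m + 1) → Fin n) = S.comp (Fin.snoc I j : Fin (m + 1) → Fin n) := by
    intro r I j
    have h := SymT.comp_perm S ((finSuccEquiv' r).trans (finSuccEquiv' (Fin.last m)).symm)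
      (Fin.snoc I j : Fin (m + 1) → Fin n)
    rw [← h]
    congr 1
    funext q
    refine Fin.succAboveCases r ?_ (fun q => ?_) q <;> simp
  have h1 : ∀ r : Fin (m + 1), ∑ I : Fin (m + 1) → Fin n,
      ((y (I r) : ℝ) : ℂ) * T.comp (I ∘ r.succAbove) * star (S.comp I) =
      ∑ I, T.comp I * star ((contract y S).comp I) := by
    intro r
    rw [← (Fin.insertNthEquiv (fun _ => Fin n) r).sum_comp, Fintype.sum_prod_type, Finset.sum_comm]
    refine Finset.sum_congr rfl fun I _ => ?_
    rw [contract_comp, star_sum, Finset.mul_sum]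
    refine Finset.sum_congr rfl fun j _ => ?_
    have : (r.insertNth j I : Fin (m + 1) → Fin n) ∘ r.succAbove = I := by funext q; simp
    simp [Fin.insertNthEquiv, hS, this]
    ring
  simp_rw [symMul_comp, mul_assoc, Finset.sum_mul]
  rw [← Finset.mul_sum, Finset.sum_comm]
  simp_rw [h1]
  have : ((m + 1 : ℕ) : ℂ) ≠ 0 := by exact_mod_cast Nat.succ_ne_zero m
  simp only [Finset.sum_const, Finset.card_univ, Fintype.card_fin, nsmul_eq_mul]
  rw [inv_mul_cancel_left₀ this]

lemma norm_sum_comp_mul_star_le (S T : SymT n m) :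
    ‖∑ I, S.comp I * star (T.comp I)‖ ≤ ‖S‖ * ‖T‖ := by
  have h := norm_inner_le_norm (𝕜 := ℂ) (T : symT n m).1 (S : symT n m).1
  rw [PiLp.inner_apply, mul_comm] at h
  exact h

lemma sum_comp_mul_star_self (T : SymT n m) :
    ∑ I, T.comp I * star (T.comp I) = ((‖T‖ ^ 2 : ℝ) : ℂ) := by
  rw [SymT.norm_sq]
  push_cast
  exact Finset.sum_congr rfl fun I _ => Complex.mul_conj' _

/-- `symMul y` is injective with a lower bound proportional to `‖y‖`. -/
lemma le_norm_symMul_sq (y : E n) (T : SymT n m) :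
    ‖y‖ ^ 2 * ‖T‖ ^ 2 ≤ (m + 1) * ‖symMul y T‖ ^ 2 := by
  have h := sum_symMul_mul_star y T (symMul y T)
  rw [sum_comp_mul_star_self] at h
  rcases m with _ | m
  · rw [contract_symMul_zero] at h
    simp only [SymT.comp_smul, star_mul', Complex.star_def, Complex.conj_ofReal] at h
    simp_rw [← Complex.star_def, mul_left_comm _ ((‖y‖ ^ 2 : ℝ) : ℂ)] at h
    rw [← Finset.mul_sum, sum_comp_mul_star_self] at h
    norm_cast at h
    simp [h]
  · rw [contract_symMul_succ] at h
    simp only [SymT.comp_smul, SymT.comp_add, star_mul', star_add, star_inv₀, star_natCast,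
      Complex.star_def, Complex.conj_ofReal] at h
    -- The second term is written as the conjugate of the product of (ι_y T) ⊙ y with T, so that
    -- adjointness turns it into |ι_y T|², a nonnegative quantity that the lower bound drops.
    have e : ∀ I, T.comp I * (((m + 2 : ℕ) : ℂ)⁻¹ * (((‖y‖ ^ 2 : ℝ) : ℂ) * star (T.comp I) +
        ((m + 1 : ℕ) : ℂ) * star ((symMul y (contract y T)).comp I))) =
        ((m + 2 : ℕ) : ℂ)⁻¹ * (((‖y‖ ^ 2 : ℝ) : ℂ) * (T.comp I * star (T.comp I)) +
        ((m + 1 : ℕ) : ℂ) * star ((symMul y (contract y T)).comp I * star (T.comp I))) := by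
      intro I; rw [star_mul', star_star]; ring
    simp_rw [← Complex.star_def] at h
    simp_rw [e] at h
    rw [← Finset.mul_sum, Finset.sum_add_distrib, ← Finset.mul_sum, ← Finset.mul_sum, ← star_sum,
      sum_symMul_mul_star, sum_comp_mul_star_self, sum_comp_mul_star_self, Complex.star_def,
      Complex.conj_ofReal] at h
    rw [eq_inv_mul_iff_mul_eq₀ (by exact_mod_cast Nat.succ_ne_zero (m + 1))] at h
    have h' : ((m : ℝ) + 2) * ‖symMul y T‖ ^ 2 =
        ‖y‖ ^ 2 * ‖T‖ ^ 2 + (m + 1) * ‖contract y T‖ ^ 2 := by exact_mod_cast h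
    push_cast
    rw [show (m : ℝ) + 1 + 1 = m + 2 by ring, h']
    nlinarith [sq_nonneg ‖contract y T‖, (Nat.cast_nonneg m : (0 : ℝ) ≤ m), sq_nonneg ‖y‖,
      sq_nonneg ‖T‖]

/-- Adjointness and Cauchy–Schwarz give |T ⊙ y|² ≤ |T| |ι_y(T ⊙ y)|; combine with
`le_norm_symMul_sq` and divide by |T|. -/
lemma le_norm_contract_symMul (y : E n) (T : SymT n m) :
    ‖y‖ ^ 2 * ‖T‖ ≤ (m + 1) * ‖contract y (symMul y T)‖ := by
  have h := sum_symMul_mul_star y T (symMul y T)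
  rw [sum_comp_mul_star_self] at h
  have h2 := norm_sum_comp_mul_star_le T (contract y (symMul y T))
  rw [← h, Complex.norm_real, Real.norm_of_nonneg (by positivity)] at h2
  have h3 := le_norm_symMul_sq y T
  rcases (norm_nonneg T).eq_or_lt with h0 | h0
  · rw [← h0]; simp only [mul_zero]; positivity
  · refine le_of_mul_le_mul_right ?_ h0
    calc _ = ‖y‖ ^ 2 * ‖T‖ ^ 2 := by ring
      _ ≤ (m + 1) * ‖symMul y T‖ ^ 2 := h3
      _ ≤ (m + 1) * (‖T‖ * ‖contract y (symMul y T)‖) := by gcongr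
      _ = _ := by ring

/-! ### Iterates -/

/-- The iterated symmetric product `T ↦ T ⊙ y^{⊙ i}`. -/
def mulPow (y : E n) : (i : ℕ) → {k m : ℕ} → k + i = m → SymT n k →L[ℂ] SymT n m
  | 0, _, _, rfl => ContinuousLinearMap.id ℂ _
  | i + 1, k, _, h => mulPow y i (k := k + 1) (by omega) ∘L symMul y

/-- The iterated contraction with `y`. -/
def conPow (y : E n) : (i : ℕ) → {k m : ℕ} → k + i = m → SymT n m →L[ℂ] SymT n k
  | 0, _, _, rfl => ContinuousLinearMap.id ℂ _
  | i + 1, k, _, h => contract y ∘L conPow y i (k := k + 1) (by omega)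

/-- `mulPow` recurses on the innermost product and `conPow` on the outermost contraction. This lemma
and the next peel off the other end, so that in `conPow y i _ (mulPow y j _ T)` the innermost
contraction meets the outermost product. -/
lemma mulPow_succ (y : E n) (i : ℕ) (h : k + i = m) (h' : k + (i + 1) = m + 1) (T : SymT n k) :
    mulPow y (i + 1) h' T = symMul y (mulPow y i h T) := by
  induction i generalizing k m with
  | zero => obtain rfl : k = m := h; rfl
  | succ i ih =>
    change mulPow y (i + 1) (k := k + 1) (m := m + 1) (by omega) (symMul y T) = _
    rw [ih (k := k + 1) (m := m) (by omega) (by omega) (symMul y T)]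
    rfl

lemma conPow_succ (y : E n) (i : ℕ) (h : k + i = m) (h' : k + (i + 1) = m + 1)
    (T : SymT n (m + 1)) : conPow y (i + 1) h' T = conPow y i h (contract y T) := by
  induction i generalizing k m with
  | zero => obtain rfl : k = m := h; rfl
  | succ i ih =>
    change contract y (conPow y (i + 1) (k := k + 1) (m := m + 1) (by omega) T) = _
    rw [ih (k := k + 1) (m := m) (by omega) (by omega) T]
    rfl

/-- `T` is annihilated by contraction with `y`. -/
def IsTangent (y : E n) (T : SymT n k) : Prop := ∀ (j : ℕ) (h : j + 1 = k), conPow y 1 h T = 0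

lemma isTangent_succ {y : E n} {T : SymT n (k + 1)} : IsTangent y T ↔ contract y T = 0 :=
  ⟨fun h => h k rfl, fun h j hj => by
    obtain rfl : j = k := by omega
    exact h⟩

lemma isTangent_zero (y : E n) (T : SymT n 0) : IsTangent y T := fun j h => by omega

/-- For `T` with `ι_y T = 0`, contraction lowers the power of `y` in `T ⊙ y^{j+1}`. -/
lemma exists_contract_mulPow (n k j : ℕ) : ∃ c : ℝ, 0 < c ∧ ∀ (y : E n) (T : SymT n k)
    (_ : IsTangent y T) {m : ℕ} (h : k + j = m) (h' : k + (j + 1) = m + 1),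
    contract y (mulPow y (j + 1) h' T) = ((c * ‖y‖ ^ 2 : ℝ) : ℂ) • mulPow y j h T := by
  induction j with
  | zero =>
    refine ⟨(k + 1 : ℝ)⁻¹, by positivity, fun y T hT m h h' => ?_⟩
    obtain rfl : k = m := h
    change contract y (symMul y T) = _ • T
    rcases k with _ | k
    · rw [contract_symMul_zero]; simp
    · rw [contract_symMul_succ, isTangent_succ.1 hT, map_zero, smul_zero, add_zero, smul_smul]
      push_cast; ring_nf
  | succ j ih =>
    obtain ⟨c, hc, ih⟩ := ih
    -- The recursion comes from `contract_symMul_succ` in degree k+j+1. With the initial value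
    -- 1/(k+1) it gives c = (j+1)/(k+j+1) at stage j; only positivity is used.
    refine ⟨(k + j + 2 : ℝ)⁻¹ * (1 + (k + j + 1) * c), by positivity, fun y T hT m h h' => ?_⟩
    obtain rfl : k + j + 1 = m := h
    rw [mulPow_succ y (j + 1) (m := k + j + 1) rfl, contract_symMul_succ, ih y T hT rfl rfl, map_smul,
      smul_smul, mulPow_succ y j (m := k + j) rfl, ← add_smul, smul_smul]
    congr 1
    push_cast
    ring

/-- Each contraction removes one factor y at the cost of a positive multiple of |y|². This is the
pointwise form of the fact that δ^i d^i can be inverted on solenoidal fields. -/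
lemma exists_conPow_mulPow (n k i : ℕ) : ∃ c : ℝ, 0 < c ∧ ∀ (y : E n) (T : SymT n k)
    (_ : IsTangent y T) {m : ℕ} (h : k + i = m),
    conPow y i h (mulPow y i h T) = ((c * (‖y‖ ^ 2) ^ i : ℝ) : ℂ) • T := by
  induction i with
  | zero =>
    refine ⟨1, one_pos, fun y T _ m h => ?_⟩
    obtain rfl : k = m := h
    simp [mulPow, conPow]
  | succ i ih =>
    obtain ⟨c, hc, ih⟩ := ih
    obtain ⟨d, hd, H⟩ := exists_contract_mulPow n k i
    refine ⟨d * c, by positivity, fun y T hT m h => ?_⟩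
    obtain rfl : k + i + 1 = m := h
    rw [conPow_succ y i rfl, H y T hT rfl, map_smul, ih y T hT, smul_smul]
    congr 1
    push_cast
    ring

/-- After j contractions no factor y is left, and the next one falls on the tangent tensor T. -/
lemma conPow_mulPow_of_lt (y : E n) {k k' i j : ℕ} (hji : j < i) (h : k + j = m) (h' : k' + i = m)
    {T : SymT n k} (hT : IsTangent y T) : conPow y i h' (mulPow y j h T) = 0 := by
  induction j generalizing i m with
  | zero =>
    obtain rfl : k = m := h
    obtain ⟨i, rfl⟩ : ∃ i', i = i' + 1 := ⟨i - 1, by omega⟩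
    obtain rfl : k' + i + 1 = k := by omega
    change conPow y (i + 1) h' T = 0
    rw [conPow_succ y i rfl, isTangent_succ.1 hT, map_zero]
  | succ j ih =>
    obtain ⟨i, rfl⟩ : ∃ i', i = i' + 1 := ⟨i - 1, by omega⟩
    obtain rfl : k + j + 1 = m := h
    obtain ⟨c, -, H⟩ := exists_contract_mulPow n k j
    rw [conPow_succ y i (m := k + j) (by omega), H y T hT rfl, map_smul,
      ih (by omega) rfl, smul_zero]

/-! ### Evaluation on vectors -/

/-- The value `∑ T_{i₁…iₘ} a₁^{i₁} ⋯ aₘ^{iₘ}` of a tensor on vectors. -/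
def SymT.eval (T : SymT n m) (a : Fin m → E n) : ℂ :=
  ∑ I, T.comp I * ∏ r, ((a r (I r) : ℝ) : ℂ)

lemma SymT.eval_smul (c : ℂ) (T : SymT n m) (a : Fin m → E n) : (c • T).eval a = c * T.eval a := by
  simp [SymT.eval, SymT.comp_smul, Finset.mul_sum, mul_assoc]

lemma SymT.eval_zero (a : Fin m → E n) : (0 : SymT n m).eval a = 0 := by
  simpa using SymT.eval_smul 0 (0 : SymT n m) a

lemma SymT.eval_add (S T : SymT n m) (a : Fin m → E n) : (S + T).eval a = S.eval a + T.eval a := by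
  simp [SymT.eval, SymT.comp_add, add_mul, Finset.sum_add_distrib]

lemma SymT.eval_sum {ι : Type*} (s : Finset ι) (T : ι → SymT n m) (a : Fin m → E n) :
    (∑ i ∈ s, T i).eval a = ∑ i ∈ s, (T i).eval a :=
  map_sum (⟨⟨fun T : SymT n m => T.eval a, SymT.eval_zero a⟩, fun S T => SymT.eval_add S T a⟩ :
    SymT n m →+ ℂ) _ _

lemma SymT.eval_perm (T : SymT n m) (a : Fin m → E n) (π : Equiv.Perm (Fin m)) :
    T.eval (a ∘ π) = T.eval a := by
  unfold SymT.eval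
  rw [← (Equiv.arrowCongr π.symm (Equiv.refl (Fin n))).sum_comp]
  refine Finset.sum_congr rfl fun I _ => ?_
  have h1 : (Equiv.arrowCongr π.symm (Equiv.refl (Fin n))) I = I ∘ π := by ext; simp
  rw [h1, T.comp_perm]
  congr 1
  exact Equiv.prod_comp π fun r => ((a r (I r) : ℝ) : ℂ)

lemma SymT.eval_eq_contract (T : SymT n (m + 1)) (a : Fin (m + 1) → E n) :
    T.eval a = (contract (a (Fin.last m)) T).eval (Fin.init a) := by
  unfold SymT.eval
  rw [← (Fin.snocEquiv fun _ => Fin n).sum_comp, Fintype.sum_prod_type, Finset.sum_comm]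
  refine Finset.sum_congr rfl fun I _ => ?_
  rw [contract_comp, Finset.sum_mul]
  refine Finset.sum_congr rfl fun j _ => ?_
  simp [Fin.snocEquiv, Fin.prod_univ_castSucc, Fin.init]
  ring

/-- By symmetry the vector y can be moved to the last slot, where evaluation is contraction. -/
lemma SymT.eval_eq_zero {y : E n} {T : SymT n k} (hT : IsTangent y T) {a : Fin k → E n}
    {r : Fin k} (hr : a r = y) : T.eval a = 0 := by
  rcases k with _ | k
  · exact r.elim0
  · rw [← T.eval_perm a (Equiv.swap r (Fin.last k)), SymT.eval_eq_contract]
    simp [hr, isTangent_succ.1 hT, SymT.eval_zero]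

/-- Every term of the symmetrization carries a factor ⟨y, a_r⟩ = 0. -/
lemma SymT.eval_symMul (y : E n) (T : SymT n m) {a : Fin (m + 1) → E n}
    (ha : ∀ r, inner ℝ (a r) y = 0) : (symMul y T).eval a = 0 := by
  unfold SymT.eval
  simp_rw [symMul_comp, mul_assoc, Finset.sum_mul]
  rw [← Finset.mul_sum, Finset.sum_comm]
  refine mul_eq_zero_of_right _ (Finset.sum_eq_zero fun r _ => ?_)
  rw [← (Fin.insertNthEquiv (fun _ => Fin n) r).sum_comp, Fintype.sum_prod_type, Finset.sum_comm]
  refine Finset.sum_eq_zero fun I _ => ?_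
  have h0 : ∑ j, ((y j : ℝ) : ℂ) * ((a r j : ℝ) : ℂ) = 0 := by
    have := ha r
    rw [PiLp.inner_apply] at this
    have h2 := congrArg (Complex.ofReal) this
    push_cast at h2
    simpa using h2
  rw [← zero_mul (T.comp I * ∏ q : Fin m, ((a (r.succAbove q) (I q) : ℝ) : ℂ)), ← h0,
    Finset.sum_mul]
  refine Finset.sum_congr rfl fun j _ => ?_
  have : (r.insertNth j I : Fin (m + 1) → Fin n) ∘ r.succAbove = I := by funext q; simp
  simp [Fin.insertNthEquiv, this, Fin.prod_univ_succAbove _ r]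
  ring

/-- The i contractions remove only i of the j factors y; a factor y remains and meets vectors
orthogonal to it. -/
lemma eval_conPow_mulPow_of_gt (y : E n) {k k' i j : ℕ} (hij : i < j) (h : k + j = m)
    (h' : k' + i = m) {T : SymT n k} (hT : IsTangent y T) {a : Fin k' → E n}
    (ha : ∀ r, inner ℝ (a r) y = 0) : (conPow y i h' (mulPow y j h T)).eval a = 0 := by
  induction i generalizing j m with
  | zero =>
    obtain rfl : k' = m := h'
    obtain ⟨j, rfl⟩ : ∃ j', j = j' + 1 := ⟨j - 1, by omega⟩
    obtain rfl : k + j + 1 = k' := by omega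
    change (mulPow y (j + 1) h T).eval a = 0
    rw [mulPow_succ y j rfl, SymT.eval_symMul _ _ ha]
  | succ i ih =>
    obtain ⟨j, rfl⟩ : ∃ j', j = j' + 1 := ⟨j - 1, by omega⟩
    obtain rfl : k + j + 1 = m := h
    obtain ⟨c, -, H⟩ := exists_contract_mulPow n k j
    rw [conPow_succ y i (m := k + j) (by omega), H y T hT rfl, map_smul, SymT.eval_smul,
      ih (by omega) rfl, mul_zero]

/-- Only the `i`-th term of `∑ V_j ⊙ y^{⊙ j}` contributes to the values of the `i`-th contraction on
vectors orthogonal to `y`. -/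
lemma eval_conPow_sum (y : E n) (V : ∀ i : Fin (m + 1), SymT n (m - i))
    (hV : ∀ i, IsTangent y (V i)) (i : Fin (m + 1)) (hi : m - i + i = m) {a : Fin (m - i) → E n}
    (ha : ∀ r, inner ℝ (a r) y = 0) (c : Fin (m + 1) → ℂ) :
    (conPow y i hi (∑ j : Fin (m + 1), c j •
      mulPow y j (Nat.sub_add_cancel (Nat.le_of_lt_succ j.2)) (V j))).eval a =
    (conPow y i hi (c i • mulPow y i hi (V i))).eval a := by
  rw [map_sum, SymT.eval_sum]
  refine Finset.sum_eq_single i (fun j _ hj => ?_) fun h => absurd (Finset.mem_univ i) h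
  rw [map_smul, SymT.eval_smul]
  rcases lt_or_gt_of_ne (Fin.val_ne_of_ne hj) with h | h
  · rw [conPow_mulPow_of_lt y h _ _ (hV j), SymT.eval_zero, mul_zero]
  · rw [eval_conPow_mulPow_of_gt y h _ _ (hV j) ha, mul_zero]

/-! ### Words and symmetric powers of frames -/

/-- T is already symmetric, so all m! terms of the symmetrization pair with it equally. -/
lemma pairing_symProd (a : Fin m → E n) (T : SymT n m) : pairing (symProd a) T = T.eval a := by
  rw [pairing_apply]
  simp only [symProd, symmetrize, LinearMap.coe_mk, AddHom.coe_mk, SymT.comp_mk,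
    Function.comp_apply]
  have h : ∀ π : Equiv.Perm (Fin m), ∑ I, T.comp I * ∏ r, ((a r (I (π r)) : ℝ) : ℂ) = T.eval a := by
    intro π
    unfold SymT.eval
    rw [← (Equiv.arrowCongr π.symm (Equiv.refl (Fin n))).sum_comp fun I =>
      T.comp I * ∏ r, ((a r (I r) : ℝ) : ℂ)]
    refine Finset.sum_congr rfl fun I _ => ?_
    have h1 : (Equiv.arrowCongr π.symm (Equiv.refl (Fin n))) I = I ∘ π := by ext; simp
    rw [h1, T.comp_perm]
    rfl
  simp_rw [mul_left_comm, Finset.mul_sum]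
  rw [Finset.sum_comm]
  simp_rw [← Finset.mul_sum, h]
  have : (m.factorial : ℂ) ≠ 0 := by exact_mod_cast m.factorial_ne_zero
  simp [Fintype.card_perm, this]

lemma pairing_symPow {ι : Type*} [Fintype ι] [DecidableEq ι] (b : ι → E n) (α : ι → ℕ)
    (J : Fin m → ι) (hJ : ∀ j, (Finset.univ.filter fun r => J r = j).card = α j) (T : SymT n m) :
    pairing (symPow b α) T = T.eval fun r => b (J r) := by
  rw [symPow_eq_symProd b α J hJ, pairing_symProd]

/-- Extending a word `J` by `i` letters `none`. -/
lemma exists_word_append {ι : Type*} [DecidableEq ι] (ℓ : ι → ℕ) (J : Fin k → ι)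
    (hJ : ∀ j, (Finset.univ.filter fun r => J r = j).card = ℓ j) (i : ℕ) :
    ∀ {m : ℕ} (h : k + i = m), ∃ J' : Fin m → Option ι,
      (∀ o, (Finset.univ.filter fun r => J' r = o).card = o.elim i ℓ) ∧
      ∀ (y : E n) (b : ι → E n) (T : SymT n m),
        T.eval (fun r => (J' r).elim y b) = (conPow y i h T).eval fun r => b (J r) := by
  induction i with
  | zero =>
    intro m h
    obtain rfl : k = m := h
    refine ⟨fun r => some (J r), fun o => ?_, fun y b T => rfl⟩
    cases o with
    | none => simp
    | some j => simpa using hJ j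
  | succ i ih =>
    intro m h
    obtain rfl : k + i + 1 = m := h
    obtain ⟨J', hJ', H⟩ := ih (m := k + i) rfl
    -- The new letter goes last because `SymT.eval_eq_contract` splits off the last vector.
    refine ⟨Fin.snoc J' none, fun o => ?_, fun y b T => ?_⟩
    · rw [Finset.card_filter, Fin.sum_univ_castSucc]
      simp only [Fin.snoc_castSucc, Fin.snoc_last]
      rw [← Finset.card_filter, hJ' o]
      cases o <;> simp
    · rw [SymT.eval_eq_contract, conPow_succ y i rfl, ← H y b]
      simp only [Fin.snoc_last, Option.elim_none]
      congr 1
      funext r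
      simp [Fin.init]

/-- This is how the transforms with last index i see T: through its i-fold contraction with ω,
evaluated on vectors of ω^⊥. -/
lemma Frame.pairing_tensor (e : Frame n) {ℓ : Fin (n - 1) → ℕ} (J : Fin k → Fin (n - 1))
    (hJ : ∀ j, (Finset.univ.filter fun r => J r = j).card = ℓ j) (i : ℕ) (h : k + i = m)
    (ω : Sph n) (T : SymT n m) :
    pairing (e.tensor ℓ i ω) T = (conPow (ω : E n) i h T).eval fun r => e.vec ω (J r) := by
  obtain ⟨J', hJ', H⟩ := exists_word_append (n := n) ℓ J hJ i h
  rw [← H, Frame.tensor, pairing_symPow _ _ J' hJ']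

lemma Frame.orthonormal_option (e : Frame n) (ω : Sph n) :
    Orthonormal ℝ fun o : Option (Fin (n - 1)) => (o.elim (ω : E n) (e.vec ω) : E n) := by
  constructor
  · rintro (_ | j)
    · simp
    · exact (e.orthonormal_vec ω).1 j
  · rintro (_ | j) (_ | j') hne
    · exact absurd rfl hne
    · exact (real_inner_comm _ _).trans (e.inner_vec ω j')
    · exact e.inner_vec ω j
    · exact (e.orthonormal_vec ω).2 fun h => hne (by rw [h])

/-- Completeness of the orthonormal basis ω, ω₁, …, ω_{n-1}: the count (n-1)+1 = n needs n ≥ 1. -/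
lemma Frame.sum_mul [NeZero n] (e : Frame n) (ω : Sph n) (i j : Fin n) :
    ∑ o : Option (Fin (n - 1)), ((o.elim (ω : E n) (e.vec ω) : E n) i) *
      ((o.elim (ω : E n) (e.vec ω) : E n) j) = if i = j then 1 else 0 := by
  have hcard : Fintype.card (Option (Fin (n - 1))) = Module.finrank ℝ (E n) := by
    have := NeZero.pos n
    simp
    omega
  have hb := coe_basisOfOrthonormalOfCardEqFinrank (e.orthonormal_option ω) hcard
  let b : OrthonormalBasis (Option (Fin (n - 1))) ℝ (E n) :=
    (basisOfOrthonormalOfCardEqFinrank (e.orthonormal_option ω) hcard).toOrthonormalBasis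
      (by rw [hb]; exact e.orthonormal_option ω)
  have hbo : ∀ o, b o = o.elim (ω : E n) (e.vec ω) := fun o => by
    simp [b]
  have h := b.sum_inner_mul_inner (stdE i) (stdE j)
  simp_rw [hbo] at h
  simpa [EuclideanSpace.inner_single_left, EuclideanSpace.inner_single_right, eq_comm] using h

/-- The expansion of a tensor in a frame. -/
lemma sum_eval_mul_prod {ι : Type*} [Fintype ι] (b : ι → E n)
    (hb : ∀ i j, ∑ o, b o i * b o j = if i = j then 1 else 0) (S : SymT n k)
    (I : Fin k → Fin n) :
    ∑ J : Fin k → ι, S.eval (fun r => b (J r)) * ∏ r, ((b (J r) (I r) : ℝ) : ℂ) = S.comp I := by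
  classical
  simp_rw [SymT.eval, Finset.sum_mul]
  rw [Finset.sum_comm]
  have h : ∀ I' : Fin k → Fin n, ∑ J : Fin k → ι, S.comp I' * (∏ r, ((b (J r) (I' r) : ℝ) : ℂ)) *
      ∏ r, ((b (J r) (I r) : ℝ) : ℂ) = if I' = I then S.comp I' else 0 := by
    intro I'
    simp_rw [mul_assoc, ← Finset.prod_mul_distrib]
    rw [← Finset.mul_sum, ← Fintype.prod_sum fun r o => ((b o (I' r) : ℝ) : ℂ) * ((b o (I r) : ℝ) : ℂ)]
    have h1 : ∀ r, ∑ o, ((b o (I' r) : ℝ) : ℂ) * ((b o (I r) : ℝ) : ℂ) =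
        if I' r = I r then 1 else 0 := fun r => by
      have := congrArg Complex.ofReal (hb (I' r) (I r))
      push_cast at this
      rw [this]
      split_ifs <;> simp
    simp_rw [h1]
    split_ifs with hI
    · simp [hI]
    · obtain ⟨r, hr⟩ := Function.ne_iff.1 hI
      rw [Finset.prod_eq_zero (Finset.mem_univ r) (if_neg hr), mul_zero]
  simp_rw [h]
  simp

/-- The expansion of a tensor annihilated by `ω` in the basis `ω₁, …, ω_{n-1}` of `ω^⊥`. -/
lemma Frame.sum_multinomial_smul_symPow [NeZero n] (e : Frame n) (ω : Sph n) (S : SymT n k)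
    (hS : IsTangent (ω : E n) S) (c : (Fin (n - 1) → ℕ) → ℂ)
    (hc : ∀ (ℓ : Fin (n - 1) → ℕ) (J : Fin k → Fin (n - 1)),
      (∀ j, (Finset.univ.filter fun r => J r = j).card = ℓ j) →
      c ℓ = S.eval fun r => e.vec ω (J r)) :
    ∑ ℓ ∈ Finset.piAntidiag (Finset.univ : Finset (Fin (n - 1))) k,
      ((Nat.multinomial Finset.univ ℓ : ℂ) * c ℓ) • (symPow (e.vec ω) ℓ : SymT n k) = S := by
  refine SymT.ext fun I => ?_
  set b : Option (Fin (n - 1)) → E n := fun o => o.elim (ω : E n) (e.vec ω) with hbdef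
  rw [SymT.comp_sum, ← sum_eval_mul_prod b (e.sum_mul ω) S I]
  have h1 : ∑ J : Fin k → Option (Fin (n - 1)), S.eval (fun r => b (J r)) *
      ∏ r, ((b (J r) (I r) : ℝ) : ℂ) = ∑ J : Fin k → Fin (n - 1),
        S.eval (fun r => e.vec ω (J r)) * ∏ r, ((e.vec ω (J r) (I r) : ℝ) : ℂ) := by
    symm
    refine Finset.sum_of_injOn (fun J r => some (J r))
      (fun J _ J' _ h => funext fun r => Option.some_injective _ (congrFun h r))
      (fun _ _ => Finset.mem_coe.2 (Finset.mem_univ _)) (fun J _ hJ => ?_) fun J _ => rfl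
    -- A word outside the image uses the letter ω, and `S` vanishes on it by tangency.
    have : ∃ r, J r = none := by
      by_contra! hne
      refine hJ ⟨fun r => (J r).get (Option.isSome_iff_ne_none.2 (hne r)), by simp, ?_⟩
      funext r; simp
    obtain ⟨r, hr⟩ := this
    rw [SymT.eval_eq_zero hS (r := r) (by simp [hbdef, hr]), zero_mul]
  have hmaps : ∀ J : Fin k → Fin (n - 1), (fun j => (Finset.univ.filter fun r => J r = j).card) ∈
      Finset.piAntidiag (Finset.univ : Finset (Fin (n - 1))) k := fun J => by
    rw [Finset.mem_piAntidiag]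
    refine ⟨?_, fun _ _ => Finset.mem_univ _⟩
    have := Finset.card_eq_sum_card_fiberwise (f := J) (s := Finset.univ) (t := Finset.univ)
      fun _ _ => Finset.mem_coe.2 (Finset.mem_univ _)
    simpa using this.symm
  -- Words are grouped by their letter counts ℓ; the value of `S` is constant on each group.
  rw [h1, ← Finset.sum_fiberwise_of_maps_to fun J _ => hmaps J]
  refine Finset.sum_congr rfl fun ℓ hℓ => ?_
  have hsum : ∑ j, ℓ j = k := (Finset.mem_piAntidiag.1 hℓ).1
  -- The multinomial coefficient is the number of words with counts ℓ, and so cancels the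
  -- normalization of `symPow` as an average over these words.
  have hfac : (Nat.multinomial Finset.univ ℓ : ℂ) *
      ((∏ j, ((ℓ j).factorial : ℂ)) / (k.factorial : ℂ)) = 1 := by
    have := Nat.multinomial_spec Finset.univ ℓ
    rw [hsum] at this
    have h2 : (∏ j, ((ℓ j).factorial : ℂ)) * (Nat.multinomial Finset.univ ℓ : ℂ) = k.factorial := by
      exact_mod_cast this
    have h3 : (k.factorial : ℂ) ≠ 0 := by exact_mod_cast k.factorial_ne_zero
    field_simp
    rw [mul_comm, h2]
  simp only [SymT.comp_smul, symPow, SymT.comp_mk]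
  rw [mul_right_comm, ← mul_assoc, hfac, one_mul, mul_comm, Finset.mul_sum]
  refine Finset.sum_congr (by ext J; simp [funext_iff]) fun J hJ => ?_
  rw [hc ℓ J fun j => congrFun (Finset.mem_filter.1 hJ).2 j]

/-! ### Pointwise decomposition -/

lemma continuous_symMul : Continuous fun y : E n => (symMul y : SymT n k →L[ℂ] SymT n (k + 1)) := by
  unfold symMul
  fun_prop

lemma continuous_contract :
    Continuous fun y : E n => (contract y : SymT n (k + 1) →L[ℂ] SymT n k) := by
  unfold contract
  fun_prop

lemma norm_sum_coord_smul_le {F G : Type*} [NormedAddCommGroup F] [NormedSpace ℂ F]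
    [NormedAddCommGroup G] [NormedSpace ℂ G] (L : Fin n → F →L[ℂ] G) (y : E n) :
    ‖∑ j, ((y j : ℝ) : ℂ) • L j‖ ≤ (∑ j, ‖L j‖) * ‖y‖ := by
  rw [Finset.sum_mul]
  refine norm_sum_le_of_le _ fun j _ => ?_
  rw [norm_smul, Complex.norm_real, mul_comm]
  gcongr
  exact PiLp.norm_apply_le y j

/-- The lower bound gives injectivity, and the dimension is finite. -/
lemma isUnit_contract_symMul {y : E n} (hy : y ≠ 0) :
    IsUnit (contract y ∘L symMul y : SymT n k →L[ℂ] SymT n k) := by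
  rw [ContinuousLinearMap.isUnit_iff_bijective]
  have hinj : Function.Injective (contract y ∘L symMul y : SymT n k →L[ℂ] SymT n k) := by
    rw [injective_iff_map_eq_zero]
    intro T hT
    have h := le_norm_contract_symMul y T
    rw [show contract y (symMul y T) = 0 from hT, norm_zero, mul_zero] at h
    have h2 : 0 < ‖y‖ ^ 2 := by have := norm_pos_iff.2 hy; positivity
    exact norm_le_zero_iff.1 (le_of_mul_le_mul_left (h.trans_eq (mul_zero _).symm) h2)
  exact ⟨hinj, LinearMap.injective_iff_surjective
    (f := (contract y ∘L symMul y : SymT n k →L[ℂ] SymT n k).toLinearMap).1 hinj⟩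

/-- The tensor `U` such that `T - U ⊙ y` is annihilated by contraction with `y`. -/
def lower (y : E n) : SymT n (k + 1) →L[ℂ] SymT n k :=
  -- `Ring.inverse` makes this total. At y = 0 the result is 0, as `contract 0 = 0`; the origin is a
  -- null set and plays no role.
  Ring.inverse (contract y ∘L symMul y : SymT n k →L[ℂ] SymT n k) ∘L contract y

lemma contract_symMul_lower {y : E n} (hy : y ≠ 0) (T : SymT n (k + 1)) :
    contract y (symMul y (lower y T)) = contract y T :=
  DFunLike.congr_fun (Ring.mul_inverse_cancel _ (isUnit_contract_symMul (k := k) hy)) (contract y T)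

/-- |y|² |U| is bounded by |ι_y(U ⊙ y)| = |ι_y T|, hence by |y| |T|, up to constants. Removing one
factor y thus costs |y|⁻¹, which accounts for the shift of both Sobolev indices by 1. -/
lemma exists_norm_lower_le (n k : ℕ) : ∃ C : ℝ, 0 ≤ C ∧ ∀ (y : E n) (_ : y ≠ 0)
    (T : SymT n (k + 1)), ‖y‖ * ‖lower y T‖ ≤ C * ‖T‖ := by
  refine ⟨(k + 1) * ∑ j : Fin n, ‖(contractE j : SymT n (k + 1) →L[ℂ] _)‖, by positivity,
    fun y hy T => ?_⟩
  have h := le_norm_contract_symMul y (lower y T)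
  rw [contract_symMul_lower hy] at h
  have h1 := (contract y).le_of_opNorm_le (norm_sum_coord_smul_le _ y) T
  refine le_of_mul_le_mul_left ?_ (norm_pos_iff.2 hy)
  calc _ = ‖y‖ ^ 2 * ‖lower y T‖ := by ring
    _ ≤ _ := h
    _ ≤ (k + 1) * (_ * ‖y‖ * ‖T‖) := by gcongr
    _ = _ := by ring

lemma continuousOn_lower :
    ContinuousOn (fun y : E n => (lower y : SymT n (k + 1) →L[ℂ] SymT n k)) {0}ᶜ := by
  intro y hy
  obtain ⟨u, hu⟩ := isUnit_contract_symMul (k := k) hy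
  have h : ContinuousAt (fun y : E n => (contract y ∘L symMul y : SymT n k →L[ℂ] SymT n k)) y :=
    (continuous_contract.clm_comp continuous_symMul).continuousAt
  have h2 := NormedRing.inverse_continuousAt u
  rw [hu] at h2
  exact ((ContinuousAt.comp (f := fun y : E n =>
    (contract y ∘L symMul y : SymT n k →L[ℂ] SymT n k)) h2 h).clm_comp
    continuous_contract.continuousAt).continuousWithinAt

/-- The projection to the tensors annihilated by contraction with `y`, along the multiples
of `y`. -/
def tangentProj (y : E n) : {k : ℕ} → SymT n k →L[ℂ] SymT n k
  | 0 => ContinuousLinearMap.id ℂ _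
  | _ + 1 => ContinuousLinearMap.id ℂ _ - symMul y ∘L lower y

lemma isTangent_tangentProj {y : E n} (hy : y ≠ 0) (T : SymT n k) :
    IsTangent y (tangentProj y T) := by
  rcases k with _ | k
  · exact isTangent_zero _ _
  · rw [isTangent_succ]
    simp [tangentProj, contract_symMul_lower hy]

lemma exists_norm_tangentProj_le (n k : ℕ) : ∃ C : ℝ, 0 ≤ C ∧ ∀ (y : E n) (_ : y ≠ 0)
    (T : SymT n k), ‖tangentProj y T‖ ≤ C * ‖T‖ := by
  rcases k with _ | k
  · exact ⟨1, zero_le_one, fun y _ T => by simp [tangentProj]⟩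
  · obtain ⟨C, hC, H⟩ := exists_norm_lower_le n k
    refine ⟨1 + (∑ j : Fin n, ‖(symMulE j : SymT n k →L[ℂ] _)‖) * C, by positivity,
      fun y hy T => ?_⟩
    calc ‖tangentProj y T‖ ≤ ‖T‖ + ‖symMul y (lower y T)‖ := norm_sub_le _ _
      _ ≤ ‖T‖ + (∑ j : Fin n, ‖(symMulE j : SymT n k →L[ℂ] _)‖) * ‖y‖ * ‖lower y T‖ := by
        gcongr; exact (symMul y).le_of_opNorm_le (norm_sum_coord_smul_le _ y) _
      _ ≤ ‖T‖ + (∑ j : Fin n, ‖(symMulE j : SymT n k →L[ℂ] _)‖) * (C * ‖T‖) := by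
        rw [mul_assoc]
        exact add_le_add_right (mul_le_mul_of_nonneg_left (H y hy T) (by positivity)) _
      _ = _ := by ring

lemma continuousOn_tangentProj :
    ContinuousOn (fun y : E n => (tangentProj y : SymT n k →L[ℂ] SymT n k)) {0}ᶜ := by
  rcases k with _ | k
  · exact continuousOn_const
  · exact continuousOn_const.sub (continuous_symMul.continuousOn.clm_comp continuousOn_lower)

/-- The iterate of `lower`. -/
def lowerPow (y : E n) : (i : ℕ) → {k m : ℕ} → k + i = m → SymT n m →L[ℂ] SymT n k
  | 0, _, _, rfl => ContinuousLinearMap.id ℂ _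
  | i + 1, k, _, h => lower y ∘L lowerPow y i (k := k + 1) (by omega)

/-- The component `v_i` in the decomposition `T = ∑ v_i ⊙ y^{⊙ i}`. -/
def component (y : E n) (i : ℕ) (h : k + i = m) : SymT n m →L[ℂ] SymT n k :=
  tangentProj y ∘L lowerPow y i h

lemma exists_norm_lowerPow_le (n i : ℕ) : ∀ {k m : ℕ} (h : k + i = m), ∃ C : ℝ, 0 ≤ C ∧
    ∀ (y : E n) (_ : y ≠ 0) (T : SymT n m), ‖y‖ ^ i * ‖lowerPow y i h T‖ ≤ C * ‖T‖ := by
  induction i with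
  | zero => rintro k m rfl; exact ⟨1, zero_le_one, fun y _ T => by simp [lowerPow]⟩
  | succ i ih =>
    intro k m h
    obtain ⟨C, hC, H⟩ := ih (k := k + 1) (m := m) (by omega)
    obtain ⟨D, hD, K⟩ := exists_norm_lower_le n k
    refine ⟨D * C, by positivity, fun y hy T => ?_⟩
    have h1 := K y hy (lowerPow y i (k := k + 1) (by omega) T)
    calc _ = ‖y‖ ^ i * (‖y‖ * ‖lower y (lowerPow y i (k := k + 1) (by omega) T)‖) := by
          rw [pow_succ, mul_assoc]; rfl
      _ ≤ ‖y‖ ^ i * (D * ‖lowerPow y i (k := k + 1) (by omega) T‖) := by gcongr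
      _ = D * (‖y‖ ^ i * ‖lowerPow y i (k := k + 1) (by omega) T‖) := by ring
      _ ≤ D * (C * ‖T‖) := mul_le_mul_of_nonneg_left (H y hy T) hD
      _ = _ := by ring

lemma continuousOn_lowerPow (i : ℕ) : ∀ {k m : ℕ} (h : k + i = m),
    ContinuousOn (fun y : E n => (lowerPow y i h : SymT n m →L[ℂ] SymT n k)) {0}ᶜ := by
  induction i with
  | zero => rintro k m rfl; exact continuousOn_const
  | succ i ih => exact fun h => continuousOn_lower.clm_comp (ih (by omega))

lemma exists_norm_component_le (n i : ℕ) (h : k + i = m) : ∃ C : ℝ, 0 ≤ C ∧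
    ∀ (y : E n) (_ : y ≠ 0) (T : SymT n m), ‖y‖ ^ i * ‖component y i h T‖ ≤ C * ‖T‖ := by
  obtain ⟨C, hC, H⟩ := exists_norm_lowerPow_le n i h
  obtain ⟨D, hD, K⟩ := exists_norm_tangentProj_le n k
  refine ⟨D * C, by positivity, fun y hy T => ?_⟩
  calc _ ≤ ‖y‖ ^ i * (D * ‖lowerPow y i h T‖) := by gcongr; exact K y hy _
    _ = D * (‖y‖ ^ i * ‖lowerPow y i h T‖) := by ring
    _ ≤ D * (C * ‖T‖) := mul_le_mul_of_nonneg_left (H y hy T) hD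
    _ = _ := by ring

lemma continuousOn_component (i : ℕ) (h : k + i = m) :
    ContinuousOn (fun y : E n => (component y i h : SymT n m →L[ℂ] SymT n k)) {0}ᶜ :=
  continuousOn_tangentProj.clm_comp (continuousOn_lowerPow i h)

lemma mulPow_component_zero (y : E n) (i : ℕ) (h : 0 + i = m) (T : SymT n m) :
    mulPow y i h (component y i h T) = mulPow y i h (lowerPow y i h T) := rfl

/-- Projecting to tangent tensors subtracts exactly the remainder passed to the next step, so the
sum of the components telescopes. -/
lemma mulPow_component_succ (y : E n) (i : ℕ) (h : k + 1 + i = m) (T : SymT n m) :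
    mulPow y i h (component y i h T) = mulPow y i h (lowerPow y i h T) -
      mulPow y (i + 1) (k := k) (by omega) (lowerPow y (i + 1) (k := k) (by omega) T) := by
  change mulPow y i h (lowerPow y i h T - symMul y (lower y (lowerPow y i h T))) = _
  rw [map_sub]
  rfl

/-- The pointwise decomposition `T = ∑ v_i ⊙ y^{⊙ i}`. -/
lemma sum_mulPow_component (y : E n) (T : SymT n m) :
    ∑ i : Fin (m + 1), mulPow y i (Nat.sub_add_cancel (Nat.le_of_lt_succ i.2))
      (component y i (Nat.sub_add_cancel (Nat.le_of_lt_succ i.2)) T) = T := by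
  -- The i-th remainder, extended by 0 beyond m to match degree 0, where nothing is subtracted. The
  -- telescoping needs no y ≠ 0; only tangency of the components does.
  set g : ℕ → SymT n m := fun i => if h : i ≤ m then
    mulPow y i (Nat.sub_add_cancel h) (lowerPow y i (Nat.sub_add_cancel h) T) else 0 with hg
  have hgk : ∀ (i k : ℕ) (h : k + i = m), mulPow y i h (lowerPow y i h T) = g i := by
    intro i k h
    obtain rfl : k = m - i := by omega
    simp only [hg]
    rw [dif_pos (by omega)]
  have key : ∀ (i k : ℕ) (h : k + i = m), mulPow y i h (component y i h T) = g i - g (i + 1) := by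
    intro i k h
    rcases k with _ | k
    · rw [mulPow_component_zero, hgk, show g (i + 1) = 0 from dif_neg (by omega), sub_zero]
    · rw [mulPow_component_succ, hgk, hgk]
  rw [Finset.sum_congr rfl fun (i : Fin (m + 1)) _ => key i (m - i) _, Fin.sum_univ_eq_sum_range (fun i => g i - g (i + 1)),
    Finset.sum_range_sub', show g (m + 1) = 0 from dif_neg (by omega), sub_zero, ← hgk 0 m rfl]
  rfl

/-! ### The Fourier transform on `H^s_t` -/

section Hat

variable {n : ℕ} (s t : ℝ)
  {F G : Type*} [NormedAddCommGroup F] [NormedSpace ℂ F] [NormedAddCommGroup G] [NormedSpace ℂ G]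

lemma wt_pos {r : ℝ} (hr : r ≠ 0) : 0 < wt s t r := by
  have := abs_pos.2 hr
  unfold wt
  positivity

/-- The weight is positive off σ = 0, so the null sets do not depend on s and t. This allows
identities to pass between spaces of different orders. -/
lemma ae_sphMeasure_iff {p : Sph n × ℝ → Prop} :
    (∀ᵐ z ∂(sphMeasure n s t), p z) ↔
      ∀ᵐ z ∂((volume : Measure (E n)).toSphere.prod (volume : Measure ℝ)), p z := by
  have hwm : Measurable fun σ : ℝ => ENNReal.ofReal (wt s t σ) := (measurable_wt _ _).ennreal_ofReal
  have hwm' : Measurable fun z : Sph n × ℝ => ENNReal.ofReal (wt s t z.2) := hwm.comp measurable_snd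
  have hc : ENNReal.ofReal (1 / (2 * (2 * Real.pi) ^ (n - 1))) ≠ 0 :=
    (ENNReal.ofReal_pos.2 (by positivity)).ne'
  rw [sphMeasure, Measure.ae_ennreal_smul_measure_iff hc, prod_withDensity_right hwm,
    ae_withDensity_iff hwm']
  have hne : ∀ᵐ z : Sph n × ℝ ∂((volume : Measure (E n)).toSphere.prod (volume : Measure ℝ)),
      z.2 ≠ 0 := by
    have : ∀ᵐ σ : ℝ, σ ≠ 0 := by simp [ae_iff]
    exact Measure.quasiMeasurePreserving_snd.ae this
  constructor
  · intro h
    filter_upwards [h, hne] with z h1 h2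
    exact h1 (ENNReal.ofReal_pos.2 (wt_pos s t h2)).ne'
  · exact fun h => h.mono fun y hy _ => hy

lemma lintegral_sobMeasure {h : E n → ℝ≥0∞} (hh : AEMeasurable h) :
    ∫⁻ y, h y ∂(sobMeasure n s t) = ∫⁻ y, ENNReal.ofReal (wt s t ‖y‖) * h y := by
  have hm : Measurable fun y : E n => ENNReal.ofReal (wt s t ‖y‖) :=
    ((measurable_wt s t).comp measurable_norm).ennreal_ofReal
  exact lintegral_withDensity_eq_lintegral_mul₀ hm.aemeasurable hh

lemma ft_surjective [CompleteSpace F] : Function.Surjective (ft : 𝓢(E n, F) →ₗ[ℂ] 𝓢(E n, F)) := by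
  intro g
  refine ⟨((((2 * Real.pi) ^ (-(n : ℝ) / 2) : ℝ) : ℂ)⁻¹ • 𝓕⁻
    (SchwartzMap.compCLMOfContinuousLinearEquiv ℂ (dil n).symm g)), ?_⟩
  have hc : (((2 * Real.pi) ^ (-(n : ℝ) / 2) : ℝ) : ℂ) ≠ 0 := by
    have : (0 : ℝ) < (2 * Real.pi) ^ (-(n : ℝ) / 2) := by positivity
    exact_mod_cast this.ne'
  rw [map_smul]
  ext y
  rw [smul_apply, ft_eq, smul_smul, inv_mul_cancel₀ hc, one_smul, FourierTransform.fourier_fourierInv_eq]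
  exact congrArg g ((dil n).symm_apply_apply y)

variable [NeZero n]

lemma ae_norm_ne_zero : ∀ᵐ y : E n, y ≠ 0 := by
  have : Nontrivial (E n) := by
    have : Nonempty (Fin n) := ⟨0⟩
    infer_instance
  simp [ae_iff]

lemma ae_sobMeasure_iff {p : E n → Prop} :
    (∀ᵐ y ∂(sobMeasure n s t), p y) ↔ ∀ᵐ y : E n, p y := by
  have hm : Measurable fun y : E n => ENNReal.ofReal (wt s t ‖y‖) :=
    ((measurable_wt s t).comp measurable_norm).ennreal_ofReal
  rw [sobMeasure, ae_withDensity_iff hm]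
  constructor
  · intro h
    filter_upwards [h, ae_norm_ne_zero] with y h1 h2
    exact h1 (ENNReal.ofReal_pos.2 (wt_pos s t (norm_ne_zero_iff.2 h2))).ne'
  · exact fun h => h.mono fun y hy _ => hy

/-- Polar coordinates over the whole line cover ℝⁿ twice with density |σ|^{n-1}, positive off σ = 0;
apply them to the indicator of the exceptional set. -/
lemma ae_sph_line_iff_of_measurableSet {p : E n → Prop} (hp : MeasurableSet {y | p y}) :
    (∀ᵐ z ∂((volume : Measure (E n)).toSphere.prod (volume : Measure ℝ)),
      p (z.2 • (z.1 : E n))) ↔ ∀ᵐ y : E n, p y := by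
  have hg : Measurable ({y : E n | ¬ p y}.indicator (1 : E n → ℝ≥0∞)) :=
    measurable_one.indicator hp.compl
  have hgm : Measurable fun z : Sph n × ℝ => ENNReal.ofReal (|z.2| ^ (n - 1)) *
      {y : E n | ¬ p y}.indicator (1 : E n → ℝ≥0∞) (z.2 • (z.1 : E n)) := by fun_prop
  have h := lintegral_sph_line hg
  have hcompl : MeasurableSet {y : E n | ¬ p y} := hp.compl
  rw [lintegral_indicator_one hcompl, ← lintegral_prod _ hgm.aemeasurable] at h
  have hne : ∀ᵐ z : Sph n × ℝ ∂((volume : Measure (E n)).toSphere.prod (volume : Measure ℝ)),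
      z.2 ≠ 0 := by
    have : ∀ᵐ σ : ℝ, σ ≠ 0 := by simp [ae_iff]
    exact Measure.quasiMeasurePreserving_snd.ae this
  constructor
  · intro hz
    rw [lintegral_congr_ae (g := 0), Pi.zero_def, lintegral_zero, eq_comm, mul_eq_zero] at h
    · exact ae_iff.2 (h.resolve_left (by simp))
    · filter_upwards [hz] with z hz
      simp [hz]
  · intro hy
    rw [ae_iff.1 hy, mul_zero, lintegral_eq_zero_iff hgm] at h
    filter_upwards [h, hne] with z h1 h2
    by_contra hc
    simp [hc] at h1
    exact h2 h1.1

/-- In this direction measurability is not needed: the exceptional set is enlarged to a measurable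
null set. -/
lemma ae_sph_line {p : E n → Prop} (h : ∀ᵐ y : E n, p y) (s t : ℝ) :
    ∀ᵐ z ∂(sphMeasure n s t), p (z.2 • (z.1 : E n)) := by
  rw [ae_sphMeasure_iff]
  have h0 := measure_toMeasurable (μ := volume) {y : E n | ¬ p y}
  rw [ae_iff.1 h] at h0
  have h1 : ∀ᵐ y : E n, y ∈ (toMeasurable volume {y : E n | ¬ p y})ᶜ := by
    rw [ae_iff]; simpa using h0
  have h2 := (ae_sph_line_iff_of_measurableSet
    (p := fun y => y ∈ (toMeasurable volume {y : E n | ¬ p y})ᶜ)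
    (measurableSet_toMeasurable _ _).compl).2 h1
  filter_upwards [h2] with z hz
  by_contra hc
  exact hz (subset_toMeasurable volume {y : E n | ¬ p y} hc)

variable [Fact (-(n : ℝ) / 2 < t)]

/-- Needed for the density of Schwartz functions in L². On a bounded set the integrable function
(1+|y|)^{-N} is bounded below. -/
instance : IsFiniteMeasureOnCompacts (sobMeasure n s t) where
  lt_top_of_isCompact K hK := by
    obtain ⟨N, hN⟩ := (sobMeasure_hasTemperateGrowth n s t).exists_integrable
    obtain ⟨R, hR⟩ := hK.isBounded.exists_norm_le
    refine (measure_mono fun y hy => ?_).trans_lt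
      (hN.measure_ge_lt_top (ε := (1 + max R 0) ^ (-(N : ℝ))) (by positivity))
    refine Real.rpow_le_rpow_of_nonpos (by positivity) ?_ (by simp)
    have := (hR y hy).trans (le_max_left R 0)
    linarith

lemma norm_ftLp (f : 𝓢(E n, F)) : ‖ftLp n s t F f‖ = ‖toSob n s t F f‖ :=
  (UniformSpace.Completion.norm_coe (E := PreSob n s t F) f).symm

variable [CompleteSpace F]

/-- The Fourier transform on `H^s_t`. -/
def hat : Sob n s t F →L[ℂ] Lp F 2 (sobMeasure n s t) :=
  (ftLp n s t F).extendOfNorm (toSob n s t F)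

lemma hat_toSob (f : 𝓢(E n, F)) : hat s t (toSob n s t F f) = ftLp n s t F f :=
  LinearMap.extendOfNorm_eq (denseRange_toSob _ _)
    ⟨1, fun f => by rw [one_mul, norm_ftLp]⟩ f

lemma coeFn_hat_toSob (f : 𝓢(E n, F)) : hat s t (toSob n s t F f) =ᵐ[volume] ft f := by
  rw [hat_toSob]
  exact (ae_sobMeasure_iff s t).1 (SchwartzMap.coeFn_toLp _ _ _)

lemma norm_hat (f : Sob n s t F) : ‖hat s t f‖ = ‖f‖ :=
  (denseRange_toSob s t).induction_on f (isClosed_eq (by fun_prop) (by fun_prop)) fun f => by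
    rw [hat_toSob, norm_ftLp]

lemma isometry_hat : Isometry (hat s t : Sob n s t F → _) :=
  AddMonoidHomClass.isometry_of_norm _ (norm_hat s t)

/-- The range of an isometry on a complete space is closed, and it contains the dense set of
Schwartz functions because `ft` is onto. Elements of H^s_t can therefore be constructed by
prescribing their Fourier transforms. -/
lemma hat_surjective :
    Function.Surjective (hat s t : Sob n s t F → Lp F 2 (sobMeasure n s t)) := by
  have hcl : IsClosed (Set.range (hat s t : Sob n s t F → Lp F 2 (sobMeasure n s t))) :=
    (isometry_hat s t).isClosedEmbedding.isClosed_range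
  have hd : DenseRange (SchwartzMap.toLpCLM ℝ F 2 (sobMeasure n s t)) :=
    SchwartzMap.denseRange_toLpCLM (by simp)
  intro g
  have hsub : Set.range (SchwartzMap.toLpCLM ℝ F 2 (sobMeasure n s t)) ⊆
      Set.range (hat s t : Sob n s t F → Lp F 2 (sobMeasure n s t)) := by
    rintro _ ⟨u, rfl⟩
    obtain ⟨f, rfl⟩ := ft_surjective u
    exact ⟨toSob n s t F f, hat_toSob s t f⟩
  exact closure_minimal hsub hcl (hd g)

variable {s t}

lemma hat_ext {f g : Sob n s t F} (h : hat s t f =ᵐ[volume] hat s t g) : f = g :=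
  (isometry_hat s t).injective (Lp.ext ((ae_sobMeasure_iff s t).2 h))

/-- A formula for an operator on the Fourier side extends from the Schwartz functions. -/
lemma coeFn_eq_of_toSob {α : Type*} {_ : MeasurableSpace α} {μ : Measure α}
    (T : Sob n s t F →L[ℂ] Lp G 2 μ) (π : α → E n)
    (hπ : ∀ p : E n → Prop, (∀ᵐ y : E n, p y) → ∀ᵐ a ∂μ, p (π a)) (B : α → F →L[ℂ] G)
    (H : ∀ f : 𝓢(E n, F), T (toSob n s t F f) =ᵐ[μ] fun a => B a (ft f (π a)))
    (f : Sob n s t F) : T f =ᵐ[μ] fun a => B a (hat s t f (π a)) := by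
  obtain ⟨x, hx, hlim⟩ := mem_closure_iff_seq_limit.1 (denseRange_toSob s t f)
  choose u hu using hx
  -- Two successive subsequences give almost everywhere convergence of the transforms and of their
  -- images under T. The formula then passes to the limit at each point by continuity of `B a`.
  obtain rfl : (fun k => toSob n s t F (u k)) = x := funext hu
  obtain ⟨φ, hφ, h1⟩ := (tendstoInMeasure_of_tendsto_Lp
    (((hat s t).continuous.tendsto f).comp hlim)).exists_seq_tendsto_ae
  have hlim2 := hlim.comp hφ.tendsto_atTop
  obtain ⟨ψ, hψ, h2⟩ := (tendstoInMeasure_of_tendsto_Lp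
    ((T.continuous.tendsto f).comp hlim2)).exists_seq_tendsto_ae
  have h3 := hπ _ ((ae_sobMeasure_iff s t).1 h1)
  have h4 := hπ _ (ae_all_iff.2 fun k => coeFn_hat_toSob s t (u k))
  filter_upwards [h2, h3, h4, ae_all_iff.2 fun k => H (u k)] with a h2 h3 h4 h5
  refine tendsto_nhds_unique h2 ?_
  have h6 := ((B a).continuous.tendsto _).comp (h3.comp hψ.tendsto_atTop)
  refine h6.congr fun k => ?_
  simp only [Function.comp_apply]
  rw [h4, h5]

end Hat

/-! ### The operators on the Fourier side -/

lemma ft_dOp (u : 𝓢(E n, SymT n k)) (y : E n) :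
    ft (dOp u) y = Complex.I • symMul y (ft u y) := by
  rw [dOp_eq, map_sum, sum_apply, symMul, sum_apply, Finset.smul_sum]
  refine Finset.sum_congr rfl fun j _ => ?_
  rw [ft_postcomp, ft_lineDeriv, map_smul, mul_smul, EuclideanSpace.inner_single_right]
  simp

lemma ft_divOp (u : 𝓢(E n, SymT n (k + 1))) (y : E n) :
    ft (divOp u) y = Complex.I • contract y (ft u y) := by
  rw [divOp_eq, map_sum, sum_apply, contract, sum_apply, Finset.smul_sum]
  refine Finset.sum_congr rfl fun j _ => ?_
  rw [ft_postcomp, ft_lineDeriv, map_smul, mul_smul, EuclideanSpace.inner_single_right]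
  simp

lemma ft_dPow (i : ℕ) : ∀ {k m : ℕ} (h : k + i = m) (u : 𝓢(E n, SymT n k)) (y : E n),
    ft (dPow i h u) y = Complex.I ^ i • mulPow y i h (ft u y) := by
  induction i with
  | zero => rintro k m rfl u y; simp [dPow, mulPow]
  | succ i ih =>
    intro k m h u y
    change ft (dPow i (k := k + 1) _ (dOp u)) y = _ • mulPow y i (k := k + 1) _ (symMul y (ft u y))
    rw [ih, ft_dOp, map_smul, smul_smul, pow_succ]

lemma ft_divPow (i : ℕ) : ∀ {k m : ℕ} (h : k + i = m) (u : 𝓢(E n, SymT n m)) (y : E n),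
    ft (divPow i h u) y = Complex.I ^ i • conPow y i h (ft u y) := by
  induction i with
  | zero => rintro k m rfl u y; simp [divPow, conPow]
  | succ i ih =>
    intro k m h u y
    change ft (divOp (divPow i (k := k + 1) _ u)) y =
      _ • contract y (conPow y i (k := k + 1) _ (ft u y))
    rw [ft_divOp, ih, map_smul, smul_smul, pow_succ']

lemma conPow_smul (c : ℝ) (y : E n) (i : ℕ) : ∀ {k m : ℕ} (h : k + i = m) (T : SymT n m),
    conPow (c • y) i h T = ((c : ℂ) ^ i) • conPow y i h T := by
  induction i with
  | zero => rintro k m rfl T; simp [conPow]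
  | succ i ih =>
    intro k m h T
    have hc : (contract (c • y) : SymT n (k + 1) →L[ℂ] SymT n k) = (c : ℂ) • contract y := by
      unfold contract
      rw [Finset.smul_sum]
      exact Finset.sum_congr rfl fun j _ => by rw [smul_smul, ← Complex.ofReal_mul]; rfl
    change contract (c • y) (conPow (c • y) i (k := k + 1) _ T) =
      _ • contract y (conPow y i (k := k + 1) _ T)
    rw [ih, hc, map_smul, smul_apply, smul_smul, pow_succ]

lemma IsTangent.smul {y : E n} {T : SymT n k} (hT : IsTangent y T) (c : ℂ) :
    IsTangent y (c • T) := fun j h => by rw [map_smul, hT j h, smul_zero]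

lemma IsTangent.of_smul {c : ℝ} (hc : c ≠ 0) {y : E n} {T : SymT n k}
    (hT : IsTangent (c • y) T) : IsTangent y T := fun j h => by
  have := hT j h
  rw [conPow_smul, pow_one] at this
  exact (smul_eq_zero.1 this).resolve_left (by exact_mod_cast hc)

section

variable [NeZero n] {s t : ℝ} [Fact (-(n : ℝ) / 2 < t)]

lemma hat_dH (i : ℕ) (h : k + i = m) (u : Sob n (s + i) (t + i) (SymT n k)) :
    hat s t (dH s t i h u) =ᵐ[volume]
      fun y => Complex.I ^ i • mulPow y i h (hat (s + i) (t + i) u y) := by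
  refine (ae_sobMeasure_iff s t).1 (coeFn_eq_of_toSob ((hat s t).comp (dH s t i h)) id
    (fun p => (ae_sobMeasure_iff s t).2) (fun y => Complex.I ^ i • mulPow y i h) (fun f => ?_) u)
  rw [ContinuousLinearMap.comp_apply, dH_toSob]
  filter_upwards [(ae_sobMeasure_iff s t).2 (coeFn_hat_toSob s t (dPow i h f))] with y hy
  rw [hy, ft_dPow]
  rfl

lemma hat_divH (i : ℕ) (h : k + i = m) (u : Sob n s t (SymT n m)) :
    hat (s - i) t (divH s t i h u) =ᵐ[volume]
      fun y => Complex.I ^ i • conPow y i h (hat s t u y) := by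
  refine (ae_sobMeasure_iff (s - i) t).1 (coeFn_eq_of_toSob ((hat (s - i) t).comp (divH s t i h)) id
    (fun p => (ae_sobMeasure_iff (s - i) t).2) (fun y => Complex.I ^ i • conPow y i h)
    (fun f => ?_) u)
  rw [ContinuousLinearMap.comp_apply, divH_toSob]
  filter_upwards [(ae_sobMeasure_iff (s - i) t).2 (coeFn_hat_toSob (s - i) t (divPow i h f))]
    with y hy
  rw [hy, ft_divPow]
  rfl

/-- The Fourier slice theorem, carried from `hyperInt_eq` on Schwartz functions to the completion.
-/
lemma coeFn_radonH {F G : Type*} [NormedAddCommGroup F] [NormedSpace ℂ F] [NormedAddCommGroup G]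
    [NormedSpace ℂ G] [CompleteSpace F] [CompleteSpace G] (A : Sph n → F →L[ℂ] G)
    (hA : StronglyMeasurable A) (hC : ∃ C, ∀ ω, ‖A ω‖ ≤ C) (f : Sob n s t F) :
    radonH s t A hA hC f
      =ᵐ[sphMeasure n (s + ((n : ℝ) - 1) / 2) (t + ((n : ℝ) - 1) / 2)]
    fun z => (((2 * Real.pi) ^ (((n : ℝ) - 1) / 2) : ℝ) : ℂ) •
      A z.1 (hat s t f (z.2 • (z.1 : E n))) := by
  refine coeFn_eq_of_toSob (radonH s t A hA hC) (fun z : Sph n × ℝ => z.2 • (z.1 : E n))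
    (fun p hp => ae_sph_line hp _ _)
    (fun z => (((2 * Real.pi) ^ (((n : ℝ) - 1) / 2) : ℝ) : ℂ) • A z.1) (fun f => ?_) f
  rw [radonH_toSob]
  filter_upwards [MemLp.coeFn_toLp (memLp_hyperInt s t hA hC f)] with z hz
  refine hz.trans ?_
  rw [hyperInt_eq]
  rfl

/-- By the slice theorem R̄f gives f̂(σω) for almost every (ω, σ), hence f̂ almost everywhere. -/
lemma radonBar_injective {F : Type*} [NormedAddCommGroup F] [NormedSpace ℂ F] [CompleteSpace F]
    {f g : Sob n s t F} (h : radonBar s t f = radonBar s t g) : f = g := by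
  refine hat_ext ?_
  have hm : MeasurableSet {y : E n | hat s t f y = hat s t g y} :=
    (Lp.stronglyMeasurable _).measurableSet_eq_fun (Lp.stronglyMeasurable _)
  refine (ae_sph_line_iff_of_measurableSet hm).1
    ((ae_sphMeasure_iff (s + ((n : ℝ) - 1) / 2) (t + ((n : ℝ) - 1) / 2)).1 ?_)
  have hf := coeFn_radonH (s := s) (t := t) (fun _ => ContinuousLinearMap.id ℂ F)
    stronglyMeasurable_const ⟨_, fun _ => le_rfl⟩ f
  have hg := coeFn_radonH (s := s) (t := t) (fun _ => ContinuousLinearMap.id ℂ F)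
    stronglyMeasurable_const ⟨_, fun _ => le_rfl⟩ g
  have hc : (((2 * Real.pi) ^ (((n : ℝ) - 1) / 2) : ℝ) : ℂ) ≠ 0 := by
    have : (0 : ℝ) < (2 * Real.pi) ^ (((n : ℝ) - 1) / 2) := by positivity
    exact_mod_cast this.ne'
  unfold radonBar at h
  rw [h] at hf
  filter_upwards [hf, hg] with z h1 h2
  exact smul_right_injective _ hc (h1.symm.trans h2)

lemma IsSolenoidal.ae_isTangent {u : Sob n s t (SymT n k)} (hu : IsSolenoidal u) :
    ∀ᵐ y : E n, IsTangent y (hat s t u y) := by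
  rcases k with _ | k
  · exact ae_of_all _ fun y => isTangent_zero _ _
  · have h1 := hat_divH (s := s) (t := t) 1 rfl u
    rw [hu k rfl, map_zero] at h1
    filter_upwards [h1, (ae_sobMeasure_iff _ _).1 (Lp.coeFn_zero (SymT n k) 2
      (sobMeasure n (s - (1 : ℕ)) t))] with y hy h0
    rw [isTangent_succ]
    rw [h0, Pi.zero_apply, pow_one] at hy
    exact (smul_eq_zero.1 hy.symm).resolve_left Complex.I_ne_zero

lemma isSolenoidal_of_ae {u : Sob n s t (SymT n k)}
    (hu : ∀ᵐ y : E n, IsTangent y (hat s t u y)) : IsSolenoidal u := by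
  intro j h
  refine hat_ext ?_
  rw [map_zero]
  filter_upwards [hat_divH (s := s) (t := t) 1 h u, hu, (ae_sobMeasure_iff _ _).1
    (Lp.coeFn_zero (SymT n j) 2 (sobMeasure n (s - (1 : ℕ)) t))] with y hy hy' h0
  rw [hy, hy' j h, h0, smul_zero, Pi.zero_apply]

/-! ### Decompositions on the Fourier side -/

section

variable {f : Sob n s t (SymT n m)}
  {v : ∀ i : Fin (m + 1), Sob n (s + (i : ℕ)) (t + (i : ℕ)) (SymT n (m - i))}

lemma IsDecomposition.isSolenoidal (hv : IsDecomposition f v) (i : Fin (m + 1)) :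
    IsSolenoidal (v i) := by
  by_cases hi : (i : ℕ) < m
  · exact hv.solenoidal i hi
  · intro j h
    omega

lemma coeFn_finset_sum {α ι V : Type*} {_ : MeasurableSpace α} {μ : Measure α} {p : ℝ≥0∞}
    [NormedAddCommGroup V] (S : Finset ι) (φ : ι → Lp V p μ) :
    ⇑(∑ i ∈ S, φ i) =ᵐ[μ] fun x => ∑ i ∈ S, φ i x := by
  classical
  induction S using Finset.induction_on with
  | empty => simp only [Finset.sum_empty]; exact Lp.coeFn_zero V p μ
  | insert a S ha ih =>
    rw [Finset.sum_insert ha]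
    filter_upwards [Lp.coeFn_add (φ a) (∑ i ∈ S, φ i), ih] with x h1 h2
    rw [h1, Pi.add_apply, h2, Finset.sum_insert ha]

lemma hat_sum_dH : hat s t (∑ i : Fin (m + 1),
      dH s t i (Nat.sub_add_cancel (Nat.le_of_lt_succ i.2)) (v i)) =ᵐ[volume]
    fun y => ∑ i : Fin (m + 1), Complex.I ^ (i : ℕ) •
      mulPow y i (Nat.sub_add_cancel (Nat.le_of_lt_succ i.2)) (hat (s + (i : ℕ)) (t + (i : ℕ)) (v i) y) := by
  rw [map_sum]
  have h1 := (ae_sobMeasure_iff s t).1 (coeFn_finset_sum (p := 2) (μ := sobMeasure n s t)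
    Finset.univ fun i : Fin (m + 1) =>
      hat s t (dH s t i (Nat.sub_add_cancel (Nat.le_of_lt_succ i.2)) (v i)))
  have h2 := ae_all_iff.2 fun i : Fin (m + 1) =>
    hat_dH (s := s) (t := t) i (Nat.sub_add_cancel (Nat.le_of_lt_succ i.2)) (v i)
  filter_upwards [h1, h2] with y h1 h2
  rw [h1]
  exact Finset.sum_congr rfl fun i _ => h2 i

end

end

/-! ### The formula for R̄(δ^i d^i v_i) and the recovery of v_i -/

section

variable [NeZero n] {s t : ℝ} [Fact (-(n : ℝ) / 2 < t)] {f : Sob n s t (SymT n m)}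
  {v : ∀ i : Fin (m + 1), Sob n (s + (i : ℕ)) (t + (i : ℕ)) (SymT n (m - i))}

lemma hat_divH_dH (i : ℕ) (h : k + i = m) (u : Sob n (s + i) (t + i) (SymT n k)) :
    hat (s - i) t (divH s t i h (dH s t i h u)) =ᵐ[volume] fun y =>
      Complex.I ^ i • conPow y i h (Complex.I ^ i • mulPow y i h (hat (s + i) (t + i) u y)) := by
  filter_upwards [hat_divH i h (dH s t i h u), hat_dH i h u] with y h1 h2
  rw [h1, h2]

/-- The formula for the componentwise Radon transform of `δ^i d^i v_i`. -/
lemma IsDecomposition.radonBar_divH_dH (e : Frame n) (hv : IsDecomposition f v)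
    (i : Fin (m + 1)) (hi : m - i + i = m) :
    radonBar (s - (i : ℕ)) t (divH s t i hi (dH s t i hi (v i)))
      =ᵐ[sphMeasure n (s - (i : ℕ) + ((n : ℝ) - 1) / 2) (t + ((n : ℝ) - 1) / 2)]
    fun z => ∑ ℓ ∈ Finset.piAntidiag (Finset.univ : Finset (Fin (n - 1))) (m - i),
      ((Nat.multinomial Finset.univ ℓ : ℂ) * Dp (s := s) (t := t) i (grt s t m e ℓ i f) z) •
        (symPow (e.vec z.1) ℓ : SymT n (m - i)) := by
  have h1 := coeFn_radonH (s := s - (i : ℕ)) (t := t)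
    (fun _ => ContinuousLinearMap.id ℂ (SymT n (m - i)))
    stronglyMeasurable_const ⟨_, fun _ => le_rfl⟩ (divH s t i hi (dH s t i hi (v i)))
  have h2 := ae_sph_line (hat_divH_dH (s := s) (t := t) i hi (v i))
    (s - (i : ℕ) + ((n : ℝ) - 1) / 2) (t + ((n : ℝ) - 1) / 2)
  have hf : hat s t f =ᵐ[volume] _ := hv.sum_eq ▸ hat_sum_dH (v := v)
  have h3 := ae_sph_line hf (s - (i : ℕ) + ((n : ℝ) - 1) / 2) (t + ((n : ℝ) - 1) / 2)
  have h4 := ae_sph_line (ae_all_iff.2 fun j => (hv.isSolenoidal j).ae_isTangent)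
    (s - (i : ℕ) + ((n : ℝ) - 1) / 2) (t + ((n : ℝ) - 1) / 2)
  have h5 : ∀ᵐ z ∂(sphMeasure n (s - (i : ℕ) + ((n : ℝ) - 1) / 2) (t + ((n : ℝ) - 1) / 2)),
      ∀ ℓ : Fin (n - 1) → ℕ, Dp (s := s) (t := t) i (grt s t m e ℓ i f) z =
        (Complex.I * z.2) ^ (i : ℕ) • ((((2 * Real.pi) ^ (((n : ℝ) - 1) / 2) : ℝ) : ℂ) •
          pairing (e.tensor ℓ i z.1) (hat s t f (z.2 • (z.1 : E n)))) := by
    refine ae_all_iff.2 fun ℓ => ?_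
    have e1 := MemLp.coeFn_toLp (memLp_Dp s t i (grt s t m e ℓ i f))
    -- The slice formula for f holds almost everywhere for the measure of order s; the null sets are
    -- the same for order s - i.
    have e2 := (ae_sphMeasure_iff (s - (i : ℕ) + ((n : ℝ) - 1) / 2) (t + ((n : ℝ) - 1) / 2)).2
      ((ae_sphMeasure_iff _ _).1 (coeFn_radonH (s := s) (t := t)
        (fun ω => pairing (e.tensor ℓ i ω)) (e.stronglyMeasurable_tensor ℓ i)
        (e.bounded_tensor ℓ i) f))
    filter_upwards [e1, e2] with z e1 e2
    refine e1.trans ?_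
    rw [← e2]
    rfl
  have h6 := ae_sph_line (ae_norm_ne_zero (n := n))
    (s - (i : ℕ) + ((n : ℝ) - 1) / 2) (t + ((n : ℝ) - 1) / 2)
  filter_upwards [h1, h2, h3, h4, h5, h6] with z h1 h2 h3 h4 h5 h6
  obtain ⟨ω, σ⟩ := z
  simp only at h1 h2 h3 h4 h5 h6
  have hσ : σ ≠ 0 := fun h => h6 (by rw [h, zero_smul])
  set c : ℂ := (((2 * Real.pi) ^ (((n : ℝ) - 1) / 2) : ℝ) : ℂ)
  set y : E n := σ • (ω : E n) with hy
  unfold radonBar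
  rw [h1, h2, ContinuousLinearMap.id_apply]
  symm
  refine e.sum_multinomial_smul_symPow ω _ ?_ _ fun ℓ J hJ => ?_
  -- The tensor to expand is a scalar multiple of v̂_i(y), hence tangent at y = σω, and at ω since σ
  -- ≠ 0.
  · refine IsTangent.smul (IsTangent.smul ?_ _) _
    obtain ⟨d, -, H⟩ := exists_conPow_mulPow n (m - i) i
    rw [map_smul, H y _ (h4 i)]
    exact (((h4 i).smul _).smul _).of_smul hσ
  · have ha : ∀ r, inner ℝ (e.vec ω (J r)) y = 0 := fun r => by
      rw [hy, inner_smul_right, e.inner_vec, mul_zero]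
    -- On vectors of ω^⊥ only the i-th term of f̂ survives. Then ι_{σω}^i = σ^i ι_ω^i, together with
    -- the factor i^i of δ^i, supplies the (iσ)^i of ∂_p^i.
    rw [h5, h3, e.pairing_tensor J hJ i hi, SymT.eval_smul, SymT.eval_smul,
      ← eval_conPow_sum y _ h4 i hi ha fun j => Complex.I ^ (j : ℕ)]
    conv_rhs => rw [hy, conPow_smul, SymT.eval_smul]
    simp only [smul_eq_mul]
    ring

/-- The component `v_i` is determined by the transforms with last index `i`. -/
lemma IsDecomposition.eq_of_grt_eq (e : Frame n) {g : Sob n s t (SymT n m)}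
    {w : ∀ i : Fin (m + 1), Sob n (s + (i : ℕ)) (t + (i : ℕ)) (SymT n (m - i))}
    (hv : IsDecomposition f v) (hw : IsDecomposition g w) (i : Fin (m + 1))
    (h : ∀ ℓ : Fin (n - 1) → ℕ, ∑ j, ℓ j = m - i → grt s t m e ℓ i f = grt s t m e ℓ i g) :
    v i = w i := by
  have hi : m - i + i = m := Nat.sub_add_cancel (Nat.le_of_lt_succ i.2)
  have h1 : divH s t i hi (dH s t i hi (v i)) = divH s t i hi (dH s t i hi (w i)) := by
    refine radonBar_injective (Lp.ext ?_)
    filter_upwards [hv.radonBar_divH_dH e i hi, hw.radonBar_divH_dH e i hi] with z e1 e2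
    rw [e1, e2]
    refine Finset.sum_congr rfl fun ℓ hℓ => ?_
    rw [h ℓ (Finset.mem_piAntidiag.1 hℓ).1]
  -- On the Fourier side δ^i d^i multiplies a solenoidal field by i^i · i^i · d|y|^{2i}, which is
  -- nonzero off the origin and can be cancelled.
  obtain ⟨d, hd, H⟩ := exists_conPow_mulPow n (m - i) i
  refine hat_ext ?_
  have e1 := hat_divH_dH (s := s) (t := t) i hi (v i)
  rw [h1] at e1
  filter_upwards [e1, hat_divH_dH (s := s) (t := t) i hi (w i), (hv.isSolenoidal i).ae_isTangent,
    (hw.isSolenoidal i).ae_isTangent, ae_norm_ne_zero] with y e1 e2 hv hw hy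
  rw [e2, map_smul, map_smul, H y _ hv, H y _ hw] at e1
  have hI : Complex.I ^ (i : ℕ) ≠ 0 := pow_ne_zero _ Complex.I_ne_zero
  have hd' : ((d * (‖y‖ ^ 2) ^ (i : ℕ) : ℝ) : ℂ) ≠ 0 := by
    have := norm_pos_iff.2 hy
    have h2 : 0 < d * (‖y‖ ^ 2) ^ (i : ℕ) := by positivity
    exact_mod_cast h2.ne'
  exact (smul_right_injective _ hd' (smul_right_injective _ hI
    (smul_right_injective _ hI e1))).symm

end

/-! ### Existence of the decomposition -/

lemma memLp_component [NeZero n] {s t : ℝ} (i : ℕ) (h : k + i = m) (φ : Lp (SymT n m) 2 (sobMeasure n s t)) :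
    MemLp (fun y => component y i h (φ y)) 2 (sobMeasure n (s + i) (t + i)) := by
  have : Nontrivial (E n) := by
    have : Nonempty (Fin n) := ⟨0⟩
    infer_instance
  -- The component map is continuous off the origin, which is a null set.
  have hcomp : AEStronglyMeasurable (fun y : E n => (component y i h : SymT n m →L[ℂ] SymT n k)) := by
    have := (continuousOn_component (n := n) i h).aestronglyMeasurable (μ := volume)
      (measurableSet_singleton 0).compl
    rwa [restrict_compl_singleton] at this
  have hφ : StronglyMeasurable φ := Lp.stronglyMeasurable φ
  have hm : AEStronglyMeasurable (fun y : E n => component y i h (φ y)) :=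
    (isBoundedBilinearMap_apply (𝕜 := ℂ) (E := SymT n m)
      (F := SymT n k)).continuous.comp_aestronglyMeasurable (hcomp.prodMk hφ.aestronglyMeasurable)
  obtain ⟨C, hC, H⟩ := exists_norm_component_le n i h
  refine ⟨hm.mono_ac (withDensity_absolutelyContinuous _ _), lt_of_le_of_lt ?_
    (ENNReal.mul_lt_top (ENNReal.ofReal_lt_top (r := C)) (Lp.memLp φ).2)⟩
  have hle : ∫⁻ y, ‖component y i h (φ y)‖ₑ ^ 2 ∂(sobMeasure n (s + i) (t + i)) ≤
      ENNReal.ofReal (C ^ 2) * ∫⁻ y, ‖φ y‖ₑ ^ 2 ∂(sobMeasure n s t) := by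
    rw [lintegral_sobMeasure _ _ (hm.enorm.pow_const 2),
      lintegral_sobMeasure _ _ (hφ.enorm.pow_const 2).aemeasurable,
      ← lintegral_const_mul' _ _ ENNReal.ofReal_ne_top]
    refine lintegral_mono_ae ?_
    filter_upwards [ae_norm_ne_zero] with y hy
    have hy' : 0 < ‖y‖ := norm_pos_iff.2 hy
    rw [← ofReal_norm, ← ofReal_norm, ← ENNReal.ofReal_pow (norm_nonneg _),
      ← ENNReal.ofReal_pow (norm_nonneg _), ← ENNReal.ofReal_mul (wt_nonneg _ _ _),
      ← ENNReal.ofReal_mul (wt_nonneg _ _ _), ← ENNReal.ofReal_mul (by positivity)]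
    refine ENNReal.ofReal_le_ofReal ?_
    -- Raising both indices by i multiplies the weight by exactly |y|^{2i}, which absorbs the
    -- |y|^{-i} growth of the component map.
    have hwt : wt (s + i) (t + i) ‖y‖ = wt s t ‖y‖ * (‖y‖ ^ i) ^ 2 := by
      rw [wt, wt, add_sub_add_right_eq_sub, mul_add, abs_norm, Real.rpow_add hy',
        show (2 * (i : ℝ)) = ((i * 2 : ℕ) : ℝ) by push_cast; ring, Real.rpow_natCast, pow_mul]
      ring
    have := wt_nonneg s t ‖y‖
    rw [hwt]
    calc _ = wt s t ‖y‖ * (‖y‖ ^ i * ‖component y i h (φ y)‖) ^ 2 := by ring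
      _ ≤ wt s t ‖y‖ * (C * ‖φ y‖) ^ 2 :=
        mul_le_mul_of_nonneg_left (pow_le_pow_left₀ (by positivity) (H y hy _) 2) this
      _ = _ := by ring
  rw [eLpNorm_two_eq, eLpNorm_two_eq]
  calc _ ≤ (ENNReal.ofReal (C ^ 2) * ∫⁻ y, ‖φ y‖ₑ ^ 2 ∂(sobMeasure n s t)) ^ (1 / 2 : ℝ) := by
        gcongr
    _ = _ := by
        rw [ENNReal.mul_rpow_of_nonneg _ _ (by norm_num), ENNReal.ofReal_rpow_of_nonneg
          (by positivity) (by norm_num)]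
        congr 2
        rw [← Real.sqrt_eq_rpow, Real.sqrt_sq hC]

/-- The v_i are prescribed by their Fourier transforms, the pointwise components of f̂; the factor
i^{-i} compensates the i^i in the symbol of d^i. -/
lemma exists_isDecomposition [NeZero n] {s t : ℝ} [Fact (-(n : ℝ) / 2 < t)] (f : Sob n s t (SymT n m)) :
    ∃ v : ∀ i : Fin (m + 1), Sob n (s + (i : ℕ)) (t + (i : ℕ)) (SymT n (m - i)),
      IsDecomposition f v := by
  have hi : ∀ i : Fin (m + 1), m - i + i = m := fun i => Nat.sub_add_cancel (Nat.le_of_lt_succ i.2)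
  have hex : ∀ i : Fin (m + 1), ∃ u : Sob n (s + (i : ℕ)) (t + (i : ℕ)) (SymT n (m - i)),
      hat (s + (i : ℕ)) (t + (i : ℕ)) u =ᵐ[volume] fun y =>
        (Complex.I ^ (i : ℕ))⁻¹ • component y i (hi i) (hat s t f y) := by
    intro i
    have hm := (memLp_component i (hi i) (hat s t f)).const_smul (Complex.I ^ (i : ℕ))⁻¹
    obtain ⟨u, hu⟩ := hat_surjective (s + (i : ℕ)) (t + (i : ℕ)) hm.toLp
    refine ⟨u, ?_⟩
    rw [hu]
    exact (ae_sobMeasure_iff _ _).1 hm.coeFn_toLp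
  choose v hv using hex
  refine ⟨v, hat_ext ?_, fun i _ => isSolenoidal_of_ae ?_⟩
  · filter_upwards [hat_sum_dH (v := v), ae_all_iff.2 hv] with y h1 h2
    rw [h1]
    conv_lhs => rw [← sum_mulPow_component y (hat s t f y)]
    refine Finset.sum_congr rfl fun i _ => ?_
    rw [h2 i, map_smul, smul_inv_smul₀ (pow_ne_zero _ Complex.I_ne_zero)]
  · filter_upwards [hv i, ae_norm_ne_zero] with y h1 hy
    rw [h1]
    exact (isTangent_tangentProj hy _).smul _

end TensorRadon
end

theorem mainTheorem2 (n m : ℕ) [NeZero n] (s t : ℝ) [Fact (-(n : ℝ) / 2 < t)]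
    (e : TensorRadon.Frame n) :
    -- existence and uniqueness of the decomposition of `f`
    (∀ f : TensorRadon.Sob n s t (TensorRadon.SymT n m),
      ∃! v : ∀ i : Fin (m + 1), TensorRadon.Sob n (s + (i : ℕ)) (t + (i : ℕ))
          (TensorRadon.SymT n (m - i)),
        TensorRadon.IsDecomposition f v) ∧
    -- `v i` is determined by the transforms with last index `i`
    (∀ (f g : TensorRadon.Sob n s t (TensorRadon.SymT n m))
      (v w : ∀ i : Fin (m + 1), TensorRadon.Sob n (s + (i : ℕ)) (t + (i : ℕ))
        (TensorRadon.SymT n (m - i))),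
      TensorRadon.IsDecomposition f v → TensorRadon.IsDecomposition g w →
      ∀ i : Fin (m + 1),
        (∀ ℓ : Fin (n - 1) → ℕ, ∑ j, ℓ j = m - i →
          TensorRadon.grt s t m e ℓ i f = TensorRadon.grt s t m e ℓ i g) →
        v i = w i) ∧
    -- `f` is determined by all transforms
    (∀ f g : TensorRadon.Sob n s t (TensorRadon.SymT n m),
      (∀ (ℓ : Fin (n - 1) → ℕ) (k : ℕ), ∑ j, ℓ j + k = m →
        TensorRadon.grt s t m e ℓ k f = TensorRadon.grt s t m e ℓ k g) →
      f = g) ∧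
    -- the formula for the componentwise Radon transform of `δ^i d^i v_i`
    (∀ (f : TensorRadon.Sob n s t (TensorRadon.SymT n m))
      (v : ∀ i : Fin (m + 1), TensorRadon.Sob n (s + (i : ℕ)) (t + (i : ℕ))
        (TensorRadon.SymT n (m - i))),
      TensorRadon.IsDecomposition f v →
      ∀ (i : Fin (m + 1)) (hi : m - i + i = m),
        TensorRadon.radonBar (s - (i : ℕ)) t
            (TensorRadon.divH s t i hi (TensorRadon.dH s t i hi (v i)))
          =ᵐ[TensorRadon.sphMeasure n (s - (i : ℕ) + ((n : ℝ) - 1) / 2) (t + ((n : ℝ) - 1) / 2)]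
        fun z => ∑ ℓ ∈ Finset.piAntidiag (Finset.univ : Finset (Fin (n - 1))) (m - i),
          ((Nat.multinomial Finset.univ ℓ : ℂ) *
            TensorRadon.Dp (s := s) (t := t) i (TensorRadon.grt s t m e ℓ i f) z) •
              (TensorRadon.symPow (e.vec z.1) ℓ : TensorRadon.SymT n (m - i))) := by
  refine ⟨fun f => ?_, fun f g v w hv hw i h => hv.eq_of_grt_eq e hw i h, fun f g h => ?_,
    fun f v hv i hi => hv.radonBar_divH_dH e i hi⟩
  · obtain ⟨v, hv⟩ := TensorRadon.exists_isDecomposition f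
    -- Uniqueness is the recovery of the components with both fields equal to f, where the data
    -- agree trivially.
    exact ⟨v, hv, fun w hw => funext fun i => hw.eq_of_grt_eq e hv i fun _ _ => rfl⟩
  · obtain ⟨v, hv⟩ := TensorRadon.exists_isDecomposition f
    obtain ⟨w, hw⟩ := TensorRadon.exists_isDecomposition g
    obtain rfl : v = w := funext fun i => hv.eq_of_grt_eq e hw i fun ℓ hℓ => h ℓ i (by omega)
    rw [hv.sum_eq, hw.sum_eq]
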